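/- Let $\Omega\subset\mathbb{R}^d$ be closed and convex, let $1<p<\infty$, $q>1$, $\alpha>0$, $\beta\in\mathbb{R}$. Let $W_p(\Omega)$ be the space of probability measures concentrated on $\Omega$ with finite $p$-th moment, with the Wasserstein distance of order $p$, and for a measure $\nu$ put $L_q(\nu)=\int u^q\,dx$ if $\nu=u\,\mathcal{L}^d$ and $L_q(\nu)=+\infty$ if $\nu$ has no density. Let $\mu:[0,1]\to W_p(\Omega)$ be a Lipschitz curve. A velocity field of $\mu$ is a Borel field $v:[0,1]\times\Omega\to\mathbb{R}^d$ with $v_t\in L^p(\mu_t)$ for a.e. $t$ such that, for all $\phi\in C^1_c(\mathbb{R}^d)$, the function $s\mapsto\int\nabla\phi\cdot v_s\,d\mu_s$ is integrable on $[0,1]$ and $$\int\phi\,d\mu_{t_2}-\int\phi\,d\mu_{t_1}=\int_{t_1}^{t_2}\int\nabla\phi\cdot v_s\,d\mu_s\,ds\qquad(0\le t_1<t_2\le 1).$$ Let $v$ be the tangent field of $\mu$, i.e. a velocity field such that for every velocity field $w$ one has $\|v_t\|_{L^p(\mu_t)}\le\|w_t\|_{L^p(\mu_t)}$ for a.e.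 $t$. Put $$F(t)=L_q(\mu_t),\qquad V(t)=V(\mu,t)=\int|v_t|^p\,d\mu_t,\qquad \mathfrak{F}(\mu)=\int_0^1F(t)^\alpha V(t)^\beta\,dt .$$ Let $\xi$ be the restriction to $[0,1]\times\mathbb{R}^d$ of a function in $C^\infty_c(\mathbb{R}\times\mathbb{R}^d;\mathbb{R}^d)$, let $T^\varepsilon_t(x)=x+\varepsilon\xi(t,x)$, $\mu^\varepsilon_t=(T^\varepsilon_t)_\sharp\mu_t$, and let $v^\varepsilon$ be the field defined by $$v^\varepsilon_t\,\mu^\varepsilon_t=(T^\varepsilon_t)_\sharp\Big[\Big(\nabla T^\varepsilon_t\cdot v_t+\frac{\partial T^\varepsilon}{\partial t}\Big)\mu_t\Big].$$ Put $$\tilde{\mathfrak{F}}(\mu^\varepsilon)=\int_0^1 L_q(\mu^\varepsilon_t)^\alpha\Big(\int|v^\varepsilon_t|^p\,d\mu^\varepsilon_t\Big)^\beta dt .$$ Suppose that $\mathfrak{F}(\mu)<+\infty$ and that $V(\mu,t)\ge V_0$ for a.e. $t\in[0,1]$, for some constant $V_0>0$. Then for a.e. $t$ the measure $\mu_t$ has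 a density $u_t\in L^q$; $\tilde{\mathfrak{F}}(\mu^\varepsilon)$ is finite for all $\varepsilon$ close to $0$; all the integrals below converge absolutely (the inner ones for a.e. $t$); and $\varepsilon\mapsto\tilde{\mathfrak{F}}(\mu^\varepsilon)$ is differentiable at $\varepsilon=0$ with $$\frac{d}{d\varepsilon}\tilde{\mathfrak{F}}(\mu^\varepsilon)\Big|_{\varepsilon=0}=\alpha(1-q)\int_0^1F^{\alpha-1}V^{\beta}\int_\Omega(\nabla\cdot\xi)\,u_t^q\,dx\,dt+p\beta\int_0^1F^{\alpha}V^{\beta-1}\int_\Omega|v_t|^{p-2}\Big(\nabla\xi\cdot v_t+\frac{\partial\xi}{\partial t}\Big)\cdot v_t\,d\mu_t\,dt$$ (the integrand $|v|^{p-2}(\cdots)\cdot v$ is read as $0$ where $v=0$). -/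

import Mathlib

open Set Filter Topology MeasureTheory
open scoped NNReal ENNReal ContDiff

/-- The Euclidean space `ℝ^d`. -/
abbrev EucSp (d : ℕ) : Type := EuclideanSpace ℝ (Fin d)

namespace WeightedGeodesic

variable {d : ℕ}

/-- The transport plans between two measures. -/
def couplings (μ ν : Measure (EucSp d)) : Set (Measure (EucSp d × EucSp d)) :=
  {π | π.map Prod.fst = μ ∧ π.map Prod.snd = ν}

/-- The Wasserstein distance of order `p`. -/
noncomputable def wassersteinDist (p : ℝ) (μ ν : Measure (EucSp d)) : ℝ≥0∞ :=
  (⨅ π ∈ couplings μ ν, ∫⁻ z, edist z.1 z.2 ^ p ∂π) ^ (1 / p)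

/-- `W_p(Ω)`: the probability measures concentrated on `Ω` with finite `p`-th moment, seen as
measures on `ℝ^d`. -/
structure MemWassersteinSpace (p : ℝ) (Ω : Set (EucSp d)) (μ : Measure (EucSp d)) : Prop where
  isProbabilityMeasure : IsProbabilityMeasure μ
  compl_eq_zero : μ Ωᶜ = 0
  moment_ne_top : ∫⁻ x, ‖x‖ₑ ^ p ∂μ ≠ ⊤

/-- Lipschitz curves `[0,1] → W_p(Ω)`; only the values at times in `[0,1]` matter. -/
structure IsLipschitzCurve (p : ℝ) (Ω : Set (EucSp d)) (μ : ℝ → Measure (EucSp d)) : Prop where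
  mem : ∀ t ∈ Icc (0 : ℝ) 1, MemWassersteinSpace p Ω (μ t)
  lipschitz : ∃ K : ℝ≥0, ∀ s ∈ Icc (0 : ℝ) 1, ∀ t ∈ Icc (0 : ℝ) 1,
    wassersteinDist p (μ s) (μ t) ≤ K * edist s t

/-- `v` is a velocity field of the curve `μ`: a Borel vector field on `[0,1] × Ω` with
`v_t ∈ L^p(μ_t)` for a.e. `t`, satisfying the continuity equation `∂ₜ μ + ∇ ⬝ (v μ) = 0`.
The test functions are the restrictions to the closed set `Ω` of `C^1_c(ℝ^d)` functions (they need
not vanish on `∂Ω`: there is no flux through the boundary). -/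
structure IsVelocityField (p : ℝ) (Ω : Set (EucSp d)) (μ : ℝ → Measure (EucSp d))
    (v : ℝ → EucSp d → EucSp d) : Prop where
  measurable : Measurable ((Icc (0 : ℝ) 1 ×ˢ Ω).domRestrict (Function.uncurry v))
  memLp : ∀ᵐ t ∂volume.restrict (Icc (0 : ℝ) 1), MemLp (v t) (ENNReal.ofReal p) (μ t)
  integrable : ∀ φ : EucSp d → ℝ, ContDiff ℝ 1 φ → HasCompactSupport φ →
    IntegrableOn (fun s => ∫ x, fderiv ℝ φ x (v s x) ∂μ s) (Icc (0 : ℝ) 1)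
  continuity_eq : ∀ φ : EucSp d → ℝ, ContDiff ℝ 1 φ → HasCompactSupport φ →
    ∀ t₁ ∈ Icc (0 : ℝ) 1, ∀ t₂ ∈ Icc (0 : ℝ) 1, t₁ < t₂ →
      ∫ x, φ x ∂μ t₂ - ∫ x, φ x ∂μ t₁ = ∫ s in t₁..t₂, ∫ x, fderiv ℝ φ x (v s x) ∂μ s

/-- `v` is the tangent field of `μ`: among all velocity fields, `v_t` has minimal `L^p(μ_t)` norm
for a.e. `t`. -/
structure IsTangentField (p : ℝ) (Ω : Set (EucSp d)) (μ : ℝ → Measure (EucSp d))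
    (v : ℝ → EucSp d → EucSp d) : Prop where
  isVelocityField : IsVelocityField p Ω μ v
  minimal : ∀ w, IsVelocityField p Ω μ w → ∀ᵐ t ∂volume.restrict (Icc (0 : ℝ) 1),
    eLpNorm (v t) (ENNReal.ofReal p) (μ t) ≤ eLpNorm (w t) (ENNReal.ofReal p) (μ t)

open Classical in
/-- `L_q(ν) = ∫ u^q` if `ν = u 𝓛^d`, and `+∞` if `ν` has no density. For `ν` concentrated on `Ω`
the density vanishes a.e. outside `Ω`, so the integral is the one over `Ω`. -/
noncomputable def Lq (q : ℝ) (ν : Measure (EucSp d)) : ℝ≥0∞ :=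
  if ν ≪ volume then ∫⁻ x, ν.rnDeriv volume x ^ q else ⊤

/-- `∫ |v_t|^p dμ_t`; this is `V(μ,t)` when `v` is the tangent field of `μ`. -/
noncomputable def kinetic (p : ℝ) (μ : ℝ → Measure (EucSp d)) (v : ℝ → EucSp d → EucSp d)
    (t : ℝ) : ℝ≥0∞ :=
  ∫⁻ x, ‖v t x‖ₑ ^ p ∂μ t

/-- `∫₀¹ L_q(μ_t)^α (∫ |v_t|^p dμ_t)^β dt`; this is `𝔉(μ)` when `v` is the tangent field of `μ`. -/
noncomputable def energy (p q α β : ℝ) (μ : ℝ → Measure (EucSp d)) (v : ℝ → EucSp d → EucSp d) :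
    ℝ≥0∞ :=
  ∫⁻ t in Icc (0 : ℝ) 1, Lq q (μ t) ^ α * kinetic p μ v t ^ β

/-- The curve `(T_t)_♯ μ_t`. -/
noncomputable def pushCurve (T : ℝ → EucSp d → EucSp d) (μ : ℝ → Measure (EucSp d)) :
    ℝ → Measure (EucSp d) :=
  fun t => (μ t).map (T t)

/-- The vector field `∇T_t ⬝ v_t + ∂T/∂t`. -/
noncomputable def lagrangianField (T v : ℝ → EucSp d → EucSp d) : ℝ → EucSp d → EucSp d :=
  fun t x => fderiv ℝ (T t) x (v t x) + deriv (fun s => T s x) t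

/-- The vector field `v'` on the curve `μ'_t = (T_t)_♯ μ_t` defined by
`v'_t ⬝ μ'_t = (T_t)_♯ [(∇T_t ⬝ v_t + ∂T/∂t) μ_t]`, that is, the Radon-Nikodym density
(component by component) of the right-hand side with respect to `μ'_t`. -/
noncomputable def transportedField (T : ℝ → EucSp d → EucSp d) (μ : ℝ → Measure (EucSp d))
    (v : ℝ → EucSp d → EucSp d) : ℝ → EucSp d → EucSp d :=
  fun t y => WithLp.toLp 2 fun i =>
    SignedMeasure.rnDeriv (((μ t).withDensityᵥ fun x => lagrangianField T v t x i).map (T t))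
      (pushCurve T μ t) y

/-- The map `T^ε(t,x) = x + ε ξ(t,x)`. -/
def perturb (ξ : ℝ → EucSp d → EucSp d) (ε : ℝ) : ℝ → EucSp d → EucSp d :=
  fun t x => x + ε • ξ t x

/-- The modified functional `𝔉̃(μ^ε) = ∫₀¹ L_q(μ^ε_t)^α (∫ |v^ε_t|^p dμ^ε_t)^β dt`, where
`μ^ε_t = (id + ε ξ(t,·))_♯ μ_t` and `v^ε` is the field transported from the field `v` of `μ`. -/
noncomputable def modifiedEnergy (p q α β : ℝ) (μ : ℝ → Measure (EucSp d))
    (v ξ : ℝ → EucSp d → EucSp d) (ε : ℝ) : ℝ≥0∞ :=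
  energy p q α β (pushCurve (perturb ξ ε) μ) (transportedField (perturb ξ ε) μ v)

/-- The divergence of a vector field on `ℝ^d`. -/
noncomputable def divergence (f : EucSp d → EucSp d) (x : EucSp d) : ℝ :=
  ∑ i, fderiv ℝ f x (EuclideanSpace.single i 1) i

/-- The integrand `(∇ ⬝ ξ_t) u_t^q`, where `u_t` is the density of `μ_t`. -/
noncomputable def pressureDensity (q : ℝ) (μ : ℝ → Measure (EucSp d)) (ξ : ℝ → EucSp d → EucSp d)
    (t : ℝ) (x : EucSp d) : ℝ :=
  divergence (ξ t) x * ((μ t).rnDeriv volume x).toReal ^ q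

/-- The integrand `|v_t|^{p-2} (∇ξ ⬝ v_t + ∂ξ/∂t) ⬝ v_t`. -/
noncomputable def kineticDensity (p : ℝ) (v ξ : ℝ → EucSp d → EucSp d) (t : ℝ) (x : EucSp d) : ℝ :=
  ‖v t x‖ ^ (p - 2) * inner ℝ (lagrangianField ξ v t x) (v t x)

end WeightedGeodesic

/-! For small `ε` the map `T^ε_t = id + ε ξ_t` is a homeomorphism of the space, because `ε ξ_t` is a
contraction. Both energies of the perturbed curve can then be pulled back to `μ_t`. By
`Lq_map_homeomorph` the internal energy is `∫ u^q |det(1 + ε ∇ξ)|^(1-q)`. By `kinetic_pushCurve` and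
`lagrangianField_perturb` the kinetic energy is `∫ |v + ε (∇ξ ⬝ v + ∂ₜξ)|^p dμ_t`. Their derivatives
at `0` are `(1-q) ∫ (∇ ⬝ ξ) u^q` and `p ∫ |v|^(p-2) (∇ξ ⬝ v + ∂ₜξ) ⬝ v dμ_t`.

The remaining difficulty is domination in `t`. On an interval of `ε` that does not depend on `t`,
the two energies are Lipschitz in `ε` with constants `C F(t)` and `C V(t)`; for the second, the
bound `V ≥ V₀` absorbs an additive constant. By homogeneity (`exists_rpow_mul_rpow_lipschitz`) the
product of powers is Lipschitz with constant `C' F^α V^β`, whatever the sign of `β`. This is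
integrable because `𝔉(μ) < ∞`, and `hasDerivAt_integral_of_abs_sub_le` applies.

Measurability in `t` rests on `exists_kernel_eq_on_Icc`: the continuity equation makes `t ↦ ∫ φ
dμ_t` continuous, so `μ` agrees on `[0,1]` with a Markov kernel, which has a jointly measurable
density. -/

/-! ### Differentiation under the integral with a Lipschitz bound. -/

/-- This serves twice: in space at a fixed time, and then in time. The last conclusion passes the
Lipschitz bound on to the integral, so that the spatial result supplies the domination needed in
`t`. Measurability of `f'` is not assumed, since `f'` is an a.e. limit of difference quotients. -/
theorem hasDerivAt_integral_of_abs_sub_le {X : Type*} [MeasurableSpace X] {m : Measure X}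
    {f : ℝ → X → ℝ} {f' bound : X → ℝ} {δ : ℝ} (hδ : 0 < δ)
    (hmeas : ∀ ε ∈ Metric.ball (0 : ℝ) δ, AEStronglyMeasurable (f ε) m)
    (hint : Integrable (f 0) m) (hbound : Integrable bound m)
    (hlip : ∀ᵐ x ∂m, ∀ ε ∈ Metric.ball (0 : ℝ) δ, ∀ ε' ∈ Metric.ball (0 : ℝ) δ,
      |f ε x - f ε' x| ≤ bound x * |ε - ε'|)
    (hderiv : ∀ᵐ x ∂m, HasDerivAt (fun ε => f ε x) (f' x) 0) :
    (∀ ε ∈ Metric.ball (0 : ℝ) δ, Integrable (f ε) m) ∧ Integrable f' m ∧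
      HasDerivAt (fun ε => ∫ x, f ε x ∂m) (∫ x, f' x ∂m) 0 ∧
      ∀ ε ∈ Metric.ball (0 : ℝ) δ, ∀ ε' ∈ Metric.ball (0 : ℝ) δ,
        |(∫ x, f ε x ∂m) - ∫ x, f ε' x ∂m| ≤ (∫ x, bound x ∂m) * |ε - ε'| := by
  have h0 : (0 : ℝ) ∈ Metric.ball (0 : ℝ) δ := Metric.mem_ball_self hδ
  have hf' : AEStronglyMeasurable f' m := by
    -- The shift by `2` keeps every term, including `n = 0`, strictly inside the ball of radius `δ`.
    have hu : Tendsto (fun n : ℕ => δ / ((n : ℝ) + 2)) atTop (𝓝[≠] 0) := by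
      rw [tendsto_nhdsWithin_iff]
      refine ⟨?_, Eventually.of_forall fun n => (by positivity : δ / ((n : ℝ) + 2) ≠ 0)⟩
      exact tendsto_const_nhds.div_atTop
        (tendsto_atTop_add_const_right _ _ tendsto_natCast_atTop_atTop)
    refine aestronglyMeasurable_of_tendsto_ae atTop
      (f := fun (n : ℕ) (x : X) => (δ / ((n : ℝ) + 2))⁻¹ * (f (δ / ((n : ℝ) + 2)) x - f 0 x))
      (fun n => ?_) ?_
    · refine ((hmeas _ ?_).sub hint.aestronglyMeasurable).const_mul _
      rw [Metric.mem_ball, dist_zero_right, Real.norm_eq_abs, abs_of_pos (by positivity)]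
      rw [div_lt_iff₀ (by positivity)]
      nlinarith [(Nat.cast_nonneg n : (0 : ℝ) ≤ n)]
    · filter_upwards [hderiv] with x hx
      have := hx.tendsto_slope_zero.comp hu
      simpa [Function.comp_def] using this
  have hInt : ∀ ε ∈ Metric.ball (0 : ℝ) δ, Integrable (f ε) m := by
    intro ε hε
    have : Integrable (fun x => f ε x - f 0 x) m := by
      refine (hbound.mul_const |ε - 0|).mono' ((hmeas ε hε).sub hint.aestronglyMeasurable) ?_
      filter_upwards [hlip] with x hx
      exact hx ε hε 0 h0
    exact (this.add hint).congr (ae_of_all _ fun x => by simp)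
  have key := hasDerivAt_integral_of_dominated_loc_of_lip (𝕜 := ℝ) (μ := m) (F := f) (F' := f')
    (bound := bound) (x₀ := (0 : ℝ)) (s := Metric.ball (0 : ℝ) δ) (Metric.ball_mem_nhds _ hδ)
    (by filter_upwards [Metric.ball_mem_nhds (0 : ℝ) hδ] with ε hε using hmeas ε hε) hint hf'
    (by
      filter_upwards [hlip] with x hx
      refine LipschitzOnWith.of_dist_le_mul fun ε hε ε' hε' => ?_
      rw [Real.dist_eq, Real.dist_eq, Real.coe_nnabs]
      exact (hx ε hε ε' hε').trans (by gcongr; exact le_abs_self _)) hbound hderiv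
  refine ⟨hInt, key.1, key.2, fun ε hε ε' hε' => ?_⟩
  rw [← integral_sub (hInt ε hε) (hInt ε' hε'), ← integral_mul_const, ← Real.norm_eq_abs]
  refine norm_integral_le_of_norm_le (hbound.mul_const _) ?_
  filter_upwards [hlip] with x hx using hx ε hε ε' hε'

namespace WeightedGeodesic

variable {d : ℕ}

/-! ### Pushing densities and velocities forward by a homeomorphism. -/

theorem exists_homeomorph_id_add (η : EucSp d → EucSp d) {c : ℝ≥0} (hc : c < 1)
    (hη : LipschitzWith c η) : ∃ e : EucSp d ≃ₜ EucSp d, ∀ x, e x = x + η x := by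
  have h : ApproximatesLinearOn (fun x => x + η x)
      ((ContinuousLinearEquiv.refl ℝ (EucSp d) : EucSp d ≃L[ℝ] EucSp d) :
        EucSp d →L[ℝ] EucSp d) univ c := by
    intro x _ y _
    have : x + η x - (y + η y) - ((ContinuousLinearEquiv.refl ℝ (EucSp d) : EucSp d ≃L[ℝ] EucSp d) :
        EucSp d →L[ℝ] EucSp d) (x - y) = η x - η y := by simp; abel
    rw [this]
    simpa [dist_eq_norm] using hη.dist_le_mul x y
  refine ⟨h.toHomeomorph _ ?_, fun x => rfl⟩
  -- The case `d = 0` is separate because the identity then has norm `0` instead of `1`.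
  rcases subsingleton_or_nontrivial (EucSp d) with hs | hs
  · exact Or.inl hs
  · right
    rw [ContinuousLinearEquiv.refl_symm]
    have h1 : ‖((ContinuousLinearEquiv.refl ℝ (EucSp d) : EucSp d ≃L[ℝ] EucSp d) :
        EucSp d →L[ℝ] EucSp d)‖₊ = 1 := by
      rw [ContinuousLinearEquiv.coe_refl]
      exact NNReal.eq ContinuousLinearMap.norm_id
    rw [h1]
    simpa using hc

/-- With `J = |det e'|`, the change of variables formula says that `e` pushes `J dx` to `dx`. The
image of `u dx` therefore has density `u / J`, read at `e⁻¹ y`. -/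
theorem Lq_map_homeomorph {q : ℝ} (hq : 1 < q) {ν : Measure (EucSp d)} [IsProbabilityMeasure ν]
    (hν : ν ≪ volume) (e : EucSp d ≃ₜ EucSp d) {e' : EucSp d → EucSp d →L[ℝ] EucSp d}
    (he : ∀ x, HasFDerivAt e (e' x) x) (hdet : ∀ x, (e' x).det ≠ 0)
    (hmeas : Measurable fun x => (e' x).det) :
    Lq q (ν.map e) =
      ∫⁻ x, ν.rnDeriv volume x ^ q * ENNReal.ofReal (|(e' x).det| ^ (1 - q)) := by
  set u := ν.rnDeriv volume with hu
  have hum : Measurable u := Measure.measurable_rnDeriv _ _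
  set J : EucSp d → ℝ≥0∞ := fun x => ENNReal.ofReal |(e' x).det| with hJ
  have hJm : Measurable J := (hmeas.abs).ennreal_ofReal
  have hJ0 : ∀ x, J x ≠ 0 := fun x => by simp [hJ, hdet x]
  have hJt : ∀ x, J x ≠ ⊤ := fun x => ENNReal.ofReal_ne_top
  have hmap : (volume.withDensity J).map e = volume := by
    have := map_withDensity_abs_det_fderiv_eq_addHaar (volume : Measure (EucSp d)) (s := univ)
      (f := e) (f' := e') MeasurableSet.univ.nullMeasurableSet
      (fun x _ => (he x).hasFDerivWithinAt) e.injective.injOn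
    simpa [image_univ] using this
  set h : EucSp d → ℝ≥0∞ := fun y => u (e.symm y) / J (e.symm y) with hh
  have hhm : Measurable h := (hum.div hJm).comp e.symm.continuous.measurable
  have hcomp : ∀ x, h (e x) = u x / J x := fun x => by simp [hh]
  have hem : Measurable e := e.continuous.measurable
  have hνmap : ν.map e = volume.withDensity h := by
    ext s hs
    rw [Measure.map_apply hem hs, withDensity_apply _ hs, ← hmap,
      setLIntegral_map hs hhm hem, setLIntegral_withDensity_eq_setLIntegral_mul _ hJm
        (show Measurable fun x => h (e x) from hhm.comp hem) (hem hs), ← Measure.setLIntegral_rnDeriv hν]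
    refine lintegral_congr fun x => ?_
    simp only [Pi.mul_apply, hcomp]
    rw [ENNReal.mul_div_cancel (hJ0 x) (hJt x)]
  have hac : ν.map e ≪ volume := hνmap ▸ withDensity_absolutelyContinuous _ _
  rw [Lq, if_pos hac]
  have hrn : (ν.map e).rnDeriv volume =ᵐ[volume] h := by
    rw [hνmap]; exact Measure.rnDeriv_withDensity _ hhm
  rw [lintegral_congr_ae (hrn.mono fun x hx => by simp only [hx] :
    (fun x => (ν.map e).rnDeriv volume x ^ q) =ᵐ[volume] fun x => h x ^ q)]
  -- Substituting `y = e x` gives `∫ (u / J)^q J dx`, whence the exponent `1 - q`.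
  nth_rewrite 1 [← hmap]
  rw [lintegral_map (hhm.pow_const q) hem, lintegral_withDensity_eq_lintegral_mul _ hJm
    (show Measurable fun x => h (e x) ^ q from (hhm.pow_const q).comp hem)]
  refine lintegral_congr fun x => ?_
  simp only [Pi.mul_apply, hcomp]
  have hpos : 0 < |(e' x).det| := abs_pos.2 (hdet x)
  rw [← ENNReal.ofReal_rpow_of_pos hpos, ENNReal.div_rpow_of_nonneg _ _ (by linarith),
    ENNReal.rpow_sub _ _ (hJ0 x) (hJt x), ENNReal.rpow_one]
  rw [div_eq_mul_inv, div_eq_mul_inv]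
  ring

/-- Since `T t` is injective, no averaging over fibres takes place: the image of the vector measure
has density `lagrangianField ∘ e⁻¹`, and uniqueness of the Radon-Nikodym density, with zero singular
part, identifies it componentwise. -/
theorem transportedField_comp_ae {T v : ℝ → EucSp d → EucSp d} {μ : ℝ → Measure (EucSp d)} {t : ℝ}
    [IsFiniteMeasure (μ t)] (e : EucSp d ≃ₜ EucSp d) (he : T t = e)
    (hint : Integrable (lagrangianField T v t) (μ t)) :
    ∀ᵐ x ∂μ t, transportedField T μ v t (T t x) = lagrangianField T v t x := by
  have hem : Measurable e := e.continuous.measurable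
  have hall : ∀ i : Fin d, ∀ᵐ x ∂μ t,
      transportedField T μ v t (T t x) i = lagrangianField T v t x i := by
    intro i
    have hi : Integrable (fun x => lagrangianField T v t x i) (μ t) :=
      (EuclideanSpace.proj (𝕜 := ℝ) i : EucSp d →L[ℝ] ℝ).integrable_comp hint
    set g : EucSp d → ℝ := fun y => lagrangianField T v t (e.symm y) i with hg
    have hge : ∀ x, g (e x) = lagrangianField T v t x i := fun x => by simp [hg]
    have hgi : Integrable g ((μ t).map e) := by
      have := (e.measurableEmbedding.integrable_map_iff (μ := μ t) (g := g)).2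
        (by simpa [Function.comp_def, hge] using hi)
      exact this
    have hmeq : ((μ t).withDensityᵥ fun x => lagrangianField T v t x i).map e =
        ((μ t).map e).withDensityᵥ g := by
      ext s hs
      rw [VectorMeasure.map_apply _ hem hs, withDensityᵥ_apply hi (hem hs),
        withDensityᵥ_apply hgi hs, e.measurableEmbedding.setIntegral_map]
      simp [hge]
    have hrn : g =ᵐ[(μ t).map e] SignedMeasure.rnDeriv (((μ t).withDensityᵥ
        fun x => lagrangianField T v t x i).map e) ((μ t).map e) :=
      SignedMeasure.eq_rnDeriv 0 g hgi VectorMeasure.MutuallySingular.zero_left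
        (by rw [hmeq, zero_add])
    filter_upwards [ae_of_ae_map hem.aemeasurable hrn] with x hx
    rw [hge] at hx
    simp only [transportedField, pushCurve, he, hx]
  filter_upwards [ae_all_iff.2 hall] with x hx
  ext i
  exact hx i

theorem kinetic_pushCurve {p : ℝ} {T v : ℝ → EucSp d → EucSp d} {μ : ℝ → Measure (EucSp d)} {t : ℝ}
    [IsFiniteMeasure (μ t)] (e : EucSp d ≃ₜ EucSp d) (he : T t = e)
    (hint : Integrable (lagrangianField T v t) (μ t)) :
    kinetic p (pushCurve T μ) (transportedField T μ v) t =
      ∫⁻ x, ‖lagrangianField T v t x‖ₑ ^ p ∂μ t := by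
  rw [kinetic, pushCurve, he, e.measurableEmbedding.lintegral_map]
  refine lintegral_congr_ae ?_
  filter_upwards [transportedField_comp_ae e he hint] with x hx
  rw [← he, hx]

/-! ### The Jacobian determinant near the identity. -/

theorem contDiff_det_id_add :
    ContDiff ℝ 1 fun B : EucSp d →L[ℝ] EucSp d => (ContinuousLinearMap.id ℝ (EucSp d) + B).det := by
  set b := (EuclideanSpace.basisFun (Fin d) ℝ).toBasis
  have h : ∀ B : EucSp d →L[ℝ] EucSp d, (ContinuousLinearMap.id ℝ (EucSp d) + B).det =
      ∑ σ : Equiv.Perm (Fin d), ((Equiv.Perm.sign σ : ℤ) : ℝ) *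
        ∏ i, ((EuclideanSpace.single i (1 : ℝ) : EucSp d) (σ i)
          + B (EuclideanSpace.single i 1) (σ i)) := by
    intro B
    rw [ContinuousLinearMap.det, ← LinearMap.det_toMatrix b, Matrix.det_apply']
    simp [b, LinearMap.toMatrix_apply]
  simp_rw [h]
  refine ContDiff.sum fun σ _ => contDiff_const.mul (contDiff_prod fun i _ => contDiff_const.add ?_)
  exact ((EuclideanSpace.proj (𝕜 := ℝ) (σ i) : EucSp d →L[ℝ] ℝ).comp
    (ContinuousLinearMap.apply ℝ (EucSp d) (EuclideanSpace.single i (1 : ℝ)))).contDiff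

/-- The determinant of `1 + ε M` is `1 + ε tr M` plus `ε²` times a polynomial in `ε`. -/
theorem hasDerivAt_det_id_add_smul (A : EucSp d →L[ℝ] EucSp d) :
    HasDerivAt (fun ε : ℝ => (ContinuousLinearMap.id ℝ (EucSp d) + ε • A).det)
      (∑ i, A (EuclideanSpace.single i 1) i) 0 := by
  set b := (EuclideanSpace.basisFun (Fin d) ℝ).toBasis
  set M := LinearMap.toMatrix b b (A : EucSp d →ₗ[ℝ] EucSp d) with hM
  have h : ∀ ε : ℝ, (ContinuousLinearMap.id ℝ (EucSp d) + ε • A).det =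
      1 + M.trace * ε + (((1 : Matrix (Fin d) (Fin d) (Polynomial ℝ)) +
        (Polynomial.X : Polynomial ℝ) • M.map Polynomial.C).det.divX.divX).eval ε * ε ^ 2 := by
    intro ε
    rw [← Matrix.det_one_add_smul, ContinuousLinearMap.det, ← LinearMap.det_toMatrix b]
    congr 1
    simp [hM]
  have htr : M.trace = ∑ i, A (EuclideanSpace.single i 1) i := by
    simp [hM, Matrix.trace, LinearMap.toMatrix_apply, b]
  simp_rw [h, ← htr]
  have h1 := ((hasDerivAt_id (0 : ℝ)).const_mul M.trace).const_add 1
  have h2 := ((((1 : Matrix (Fin d) (Fin d) (Polynomial ℝ)) +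
        (Polynomial.X : Polynomial ℝ) • M.map Polynomial.C).det.divX.divX).hasDerivAt 0).mul
          (hasDerivAt_pow 2 (0 : ℝ))
  convert! h1.add h2 using 1
  simp

/-- The factor `|det (1 + B)|^(1-q)` by which the density of the internal energy changes. -/
noncomputable def detPow (q : ℝ) (B : EucSp d →L[ℝ] EucSp d) : ℝ :=
  |(ContinuousLinearMap.id ℝ (EucSp d) + B).det| ^ (1 - q)

theorem detPow_zero (q : ℝ) : detPow q (0 : EucSp d →L[ℝ] EucSp d) = 1 := by
  simp [detPow, ContinuousLinearMap.det]

theorem detPow_nonneg (q : ℝ) (B : EucSp d →L[ℝ] EucSp d) : 0 ≤ detPow q B :=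
  Real.rpow_nonneg (abs_nonneg _) _

theorem measurable_detPow (q : ℝ) : Measurable (detPow q : (EucSp d →L[ℝ] EucSp d) → ℝ) :=
  (contDiff_det_id_add.continuous.measurable.abs).pow_const _

/-- `detPow q` is `C^1` near `0`, where the determinant is close to `1`, hence Lipschitz on some
ball of radius `r`. The radius `r / M` keeps `ε • A` in that ball for all `A` of norm at most `M` at
once, which makes the constants uniform in `t` and `x`. -/
theorem exists_detPow_lipschitz (q : ℝ) (M : ℝ) (hM : 0 < M) : ∃ δ > 0, ∃ C > 0,
    ∀ A : EucSp d →L[ℝ] EucSp d, ‖A‖ ≤ M →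
      (∀ ε ∈ Metric.ball (0 : ℝ) δ, (ContinuousLinearMap.id ℝ (EucSp d) + ε • A).det ≠ 0) ∧
      ∀ ε ∈ Metric.ball (0 : ℝ) δ, ∀ ε' ∈ Metric.ball (0 : ℝ) δ,
        |detPow q (ε • A) - detPow q (ε' • A)| ≤ C * |ε - ε'| := by
  have h0 : (ContinuousLinearMap.id ℝ (EucSp d) + 0).det = 1 := by
    simp [ContinuousLinearMap.det]
  have hc : ContDiffAt ℝ 1 (detPow q : (EucSp d →L[ℝ] EucSp d) → ℝ) 0 := by
    have h1 : ContDiffAt ℝ 1 (fun B : EucSp d →L[ℝ] EucSp d =>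
        |(ContinuousLinearMap.id ℝ (EucSp d) + B).det|) 0 :=
      contDiff_det_id_add.contDiffAt.abs (by rw [h0]; exact one_ne_zero)
    exact h1.rpow_const_of_ne (by rw [h0]; simp)
  obtain ⟨K, s, hs, hK⟩ := hc.exists_lipschitzOnWith
  have hne : {B : EucSp d →L[ℝ] EucSp d | (ContinuousLinearMap.id ℝ (EucSp d) + B).det ≠ 0} ∈ 𝓝 0 :=
    contDiff_det_id_add.continuous.continuousAt.eventually_ne (by rw [h0]; exact one_ne_zero)
  obtain ⟨r, hr, hrs⟩ := Metric.mem_nhds_iff.1 (inter_mem hs hne)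
  refine ⟨r / M, by positivity, (K + 1) * M, by positivity, fun A hA => ?_⟩
  have hmem : ∀ ε ∈ Metric.ball (0 : ℝ) (r / M), ε • A ∈ Metric.ball
      (0 : EucSp d →L[ℝ] EucSp d) r := by
    intro ε hε
    rw [Metric.mem_ball, dist_zero_right] at hε ⊢
    rw [norm_smul]
    calc ‖ε‖ * ‖A‖ ≤ ‖ε‖ * M := by gcongr
      _ < r / M * M := by gcongr
      _ = r := by field_simp
  refine ⟨fun ε hε => (hrs (hmem ε hε)).2, fun ε hε ε' hε' => ?_⟩
  have := hK.dist_le_mul _ (hrs (hmem ε hε)).1 _ (hrs (hmem ε' hε')).1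
  rw [Real.dist_eq, dist_eq_norm, show ε • A - ε' • A = (ε - ε') • A from (sub_smul _ _ _).symm,
    norm_smul, Real.norm_eq_abs] at this
  calc _ ≤ K * (|ε - ε'| * ‖A‖) := this
    _ ≤ (K + 1) * (|ε - ε'| * M) := by gcongr; linarith
    _ = _ := by ring

theorem hasDerivAt_detPow_smul (q : ℝ) (A : EucSp d →L[ℝ] EucSp d) :
    HasDerivAt (fun ε : ℝ => detPow q (ε • A))
      ((1 - q) * ∑ i, A (EuclideanSpace.single i 1) i) 0 := by
  have h0 : (ContinuousLinearMap.id ℝ (EucSp d) + (0 : ℝ) • A).det = 1 := by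
    simp [ContinuousLinearMap.det]
  have h1 := hasDerivAt_det_id_add_smul A
  have h2 : HasDerivAt (fun ε : ℝ => (ContinuousLinearMap.id ℝ (EucSp d) + ε • A).det ^ (1 - q))
      ((1 - q) * ∑ i, A (EuclideanSpace.single i 1) i) 0 := by
    have := h1.rpow_const (p := 1 - q) (Or.inl (by rw [h0]; exact one_ne_zero))
    rw [h0] at this
    convert this using 1
    simp; ring
  refine h2.congr_of_eventuallyEq ?_
  have : ∀ᶠ ε : ℝ in 𝓝 0, 0 < (ContinuousLinearMap.id ℝ (EucSp d) + ε • A).det :=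
    h1.continuousAt.eventually_const_lt (by simp [ContinuousLinearMap.det])
  filter_upwards [this] with ε hε
  rw [detPow, abs_of_pos hε]

/-! ### The `p`-th power of the norm along a line. -/

theorem hasDerivAt_norm_add_smul_rpow {E : Type*} [NormedAddCommGroup E] [InnerProductSpace ℝ E]
    {p : ℝ} (hp : 1 < p) (a b : E) (ε : ℝ) :
    HasDerivAt (fun ε : ℝ => ‖a + ε • b‖ ^ p)
      (p * (‖a + ε • b‖ ^ (p - 2) * inner ℝ b (a + ε • b))) ε := by
  have h1 : HasDerivAt (fun ε : ℝ => a + ε • b) b ε := by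
    simpa using ((hasDerivAt_id ε).smul_const b).const_add a
  have := (hasFDerivAt_norm_rpow (a + ε • b) hp).comp_hasDerivAt ε h1
  convert! this using 1
  rw [smul_apply, innerSL_apply_apply, real_inner_comm, smul_eq_mul, mul_assoc]

/-- For `p < 2` the first factor is singular at `a = 0`, but the inner product contributes a factor
`‖a‖`, leaving `‖a‖^(p-1) ‖b‖`. -/
theorem norm_rpow_mul_inner_le {E : Type*} [NormedAddCommGroup E] [InnerProductSpace ℝ E]
    {p : ℝ} (hp : 1 < p) (a b : E) {R : ℝ} (ha : ‖a‖ ≤ R) (hb : ‖b‖ ≤ R) :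
    |‖a‖ ^ (p - 2) * inner ℝ b a| ≤ R ^ p := by
  have hR : 0 ≤ R := (norm_nonneg _).trans ha
  rcases eq_or_ne a 0 with rfl | h0
  · simpa using Real.rpow_nonneg hR p
  have hpos : 0 < ‖a‖ := norm_pos_iff.2 h0
  rw [abs_mul, abs_of_nonneg (Real.rpow_nonneg (norm_nonneg _) _)]
  calc ‖a‖ ^ (p - 2) * |inner ℝ b a| ≤ ‖a‖ ^ (p - 2) * (‖b‖ * ‖a‖) := by
        gcongr; exact abs_real_inner_le_norm _ _
    _ = ‖a‖ ^ (p - 1) * ‖b‖ := by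
        rw [show p - 1 = (p - 2) + 1 by ring, Real.rpow_add hpos, Real.rpow_one]; ring
    _ ≤ R ^ (p - 1) * R := by
        gcongr
    _ = R ^ p := by
        rw [← Real.rpow_add_one' hR (by linarith)]; ring_nf

/-- This is the mean value inequality. On the unit interval of `ε` both `a + ε b` and `b` are
bounded by `(M + 1)(‖a‖ + 1)`, and convexity of the power splits `(‖a‖ + 1)^p`. -/
theorem abs_norm_rpow_sub_le {E : Type*} [NormedAddCommGroup E] [InnerProductSpace ℝ E]
    {p : ℝ} (hp : 1 < p) {M : ℝ} (hM : 0 ≤ M) (a b : E) (hb : ‖b‖ ≤ M * (‖a‖ + 1)) :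
    ∀ ε ∈ Metric.ball (0 : ℝ) 1, ∀ ε' ∈ Metric.ball (0 : ℝ) 1,
      |‖a + ε • b‖ ^ p - ‖a + ε' • b‖ ^ p| ≤
        p * ((M + 1) ^ p * (2 ^ (p - 1) * (‖a‖ ^ p + 1))) * |ε - ε'| := by
  intro ε hε ε' hε'
  have hR : ((M + 1) * (‖a‖ + 1)) ^ p ≤ (M + 1) ^ p * (2 ^ (p - 1) * (‖a‖ ^ p + 1)) := by
    rw [Real.mul_rpow (by positivity) (by positivity)]
    gcongr
    have h := NNReal.rpow_add_le_mul_rpow_add_rpow ‖a‖₊ 1 hp.le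
    rw [← NNReal.coe_le_coe] at h
    simpa using h
  refine (Convex.norm_image_sub_le_of_norm_hasDerivWithin_le (𝕜 := ℝ)
    (f := fun ε : ℝ => ‖a + ε • b‖ ^ p) (s := Metric.ball (0 : ℝ) 1)
    (fun x _ => (hasDerivAt_norm_add_smul_rpow hp a b x).hasDerivWithinAt) (fun x hx => ?_)
    (convex_ball _ _) hε' hε)
  rw [norm_mul, Real.norm_of_nonneg (by linarith)]
  gcongr
  refine (norm_rpow_mul_inner_le hp _ _ ?_ ?_).trans hR
  · rw [Metric.mem_ball, dist_zero_right] at hx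
    calc ‖a + x • b‖ ≤ ‖a‖ + ‖x‖ * ‖b‖ := (norm_add_le _ _).trans (by rw [norm_smul])
      _ ≤ ‖a‖ + 1 * (M * (‖a‖ + 1)) := by gcongr
      _ ≤ _ := by nlinarith [norm_nonneg a]
  · nlinarith [norm_nonneg a]

/-! ### The product of powers of the two energies. -/

/-- Dividing by `F` and `V` reduces to the single function `z₁^α z₂^β` near `(1, 1)`, which is `C^1`
for all exponents. Hence the constants depend only on `α`, `β`, `C`, and not on `F` and `V`. -/
theorem exists_rpow_mul_rpow_lipschitz (α β C : ℝ) (hC : 0 < C) : ∃ δ > 0, ∃ C' > 0,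
    ∀ F > 0, ∀ V > 0, ∀ l k : ℝ → ℝ, l 0 = F → k 0 = V → ∀ δ' ≤ δ, 0 < δ' →
      (∀ ε ∈ Metric.ball (0 : ℝ) δ', ∀ ε' ∈ Metric.ball (0 : ℝ) δ',
        |l ε - l ε'| ≤ C * F * |ε - ε'|) →
      (∀ ε ∈ Metric.ball (0 : ℝ) δ', ∀ ε' ∈ Metric.ball (0 : ℝ) δ',
        |k ε - k ε'| ≤ C * V * |ε - ε'|) →
      (∀ ε ∈ Metric.ball (0 : ℝ) δ', 0 < l ε ∧ 0 < k ε) ∧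
      ∀ ε ∈ Metric.ball (0 : ℝ) δ', ∀ ε' ∈ Metric.ball (0 : ℝ) δ',
        |l ε ^ α * k ε ^ β - l ε' ^ α * k ε' ^ β| ≤ C' * (F ^ α * V ^ β) * |ε - ε'| := by
  have hc : ContDiffAt ℝ 1 (fun z : ℝ × ℝ => z.1 ^ α * z.2 ^ β) (1, 1) :=
    (contDiffAt_fst.rpow_const_of_ne (by simp)).mul (contDiffAt_snd.rpow_const_of_ne (by simp))
  obtain ⟨K, s, hs, hK⟩ := hc.exists_lipschitzOnWith
  obtain ⟨r, hr, hrs⟩ := Metric.mem_nhds_iff.1 hs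
  -- The bound `r` keeps the normalized pair where the function is Lipschitz; the bound `1` keeps
  -- its entries positive.
  refine ⟨min r 1 / (2 * C), by positivity, (K + 1) * C, by positivity, ?_⟩
  intro F hF V hV l k hl hk δ' hδ hδ' hlL hkL
  have h0 : (0 : ℝ) ∈ Metric.ball (0 : ℝ) δ' := Metric.mem_ball_self hδ'
  have near : ∀ (f : ℝ → ℝ) (G : ℝ), 0 < G → f 0 = G →
      (∀ ε ∈ Metric.ball (0 : ℝ) δ', ∀ ε' ∈ Metric.ball (0 : ℝ) δ',
        |f ε - f ε'| ≤ C * G * |ε - ε'|) → ∀ ε ∈ Metric.ball (0 : ℝ) δ', |f ε / G - 1| < min r 1 := by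
    intro f G hG hf hL ε hε
    have h1 := hL ε hε 0 h0
    rw [Metric.mem_ball, dist_zero_right, Real.norm_eq_abs] at hε
    have h2 : |f ε / G - 1| = |f ε - f 0| / G := by
      rw [hf, ← abs_of_pos hG, ← abs_div, abs_of_pos hG]; congr 1; field_simp
    have h3 : |ε| < min r 1 / (2 * C) := hε.trans_le hδ
    rw [lt_div_iff₀ (by positivity)] at h3
    rw [h2, div_lt_iff₀ hG]
    rw [sub_zero] at h1
    have : 0 < min r 1 := by positivity
    nlinarith
  have pos : ∀ (f : ℝ → ℝ) (G : ℝ), 0 < G → (∀ ε ∈ Metric.ball (0 : ℝ) δ', |f ε / G - 1| < min r 1) →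
      ∀ ε ∈ Metric.ball (0 : ℝ) δ', 0 < f ε := by
    intro f G hG hf ε hε
    have h1 := (abs_lt.1 ((hf ε hε).trans_le (min_le_right _ _))).1
    have : 0 < f ε / G := by linarith
    exact (div_pos_iff_of_pos_right hG).1 this
  have nl := near l F hF hl hlL
  have nk := near k V hV hk hkL
  have pl := pos l F hF nl
  have pk := pos k V hV nk
  refine ⟨fun ε hε => ⟨pl ε hε, pk ε hε⟩, fun ε hε ε' hε' => ?_⟩
  have hm : ∀ ε ∈ Metric.ball (0 : ℝ) δ', (l ε / F, k ε / V) ∈ s := by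
    intro ε hε
    refine hrs ?_
    rw [Metric.mem_ball, Prod.dist_eq, max_lt_iff, Real.dist_eq, Real.dist_eq]
    exact ⟨(nl ε hε).trans_le (min_le_left _ _), (nk ε hε).trans_le (min_le_left _ _)⟩
  have hfac : ∀ ε ∈ Metric.ball (0 : ℝ) δ', l ε ^ α * k ε ^ β =
      F ^ α * V ^ β * ((l ε / F) ^ α * (k ε / V) ^ β) := by
    intro ε hε
    rw [Real.div_rpow (pl ε hε).le hF.le, Real.div_rpow (pk ε hε).le hV.le]
    have := (Real.rpow_pos_of_pos hF α).ne'
    have := (Real.rpow_pos_of_pos hV β).ne'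
    field_simp
  have hd := hK.dist_le_mul _ (hm ε hε) _ (hm ε' hε')
  have hpos : 0 < F ^ α * V ^ β :=
    mul_pos (Real.rpow_pos_of_pos hF α) (Real.rpow_pos_of_pos hV β)
  have hdist : dist (l ε / F, k ε / V) (l ε' / F, k ε' / V) ≤ C * |ε - ε'| := by
    rw [Prod.dist_eq, max_le_iff, Real.dist_eq, Real.dist_eq]
    dsimp only
    rw [← sub_div, ← sub_div, abs_div, abs_div, abs_of_pos hF, abs_of_pos hV,
      div_le_iff₀ hF, div_le_iff₀ hV]
    exact ⟨by linarith [hlL ε hε ε' hε'], by linarith [hkL ε hε ε' hε']⟩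
  rw [hfac ε hε, hfac ε' hε', ← mul_sub, abs_mul, abs_of_pos hpos]
  rw [Real.dist_eq] at hd
  calc _ ≤ F ^ α * V ^ β * (K * (C * |ε - ε'|)) := by gcongr; exact hd.trans (by gcongr)
    _ ≤ F ^ α * V ^ β * ((K + 1) * (C * |ε - ε'|)) := by gcongr; linarith
    _ = _ := by ring

theorem hasDerivAt_rpow_mul_rpow {α β F V l' k' : ℝ} {l k : ℝ → ℝ} (hF : 0 < F) (hV : 0 < V)
    (hl0 : l 0 = F) (hk0 : k 0 = V) (hl : HasDerivAt l l' 0) (hk : HasDerivAt k k' 0) :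
    HasDerivAt (fun ε => l ε ^ α * k ε ^ β)
      (α * (F ^ (α - 1) * V ^ β * l') + β * (F ^ α * V ^ (β - 1) * k')) 0 := by
  have h1 := hl.rpow_const (p := α) (Or.inl (by rw [hl0]; exact hF.ne'))
  have h2 := hk.rpow_const (p := β) (Or.inl (by rw [hk0]; exact hV.ne'))
  convert! h1.mul h2 using 1
  rw [hl0, hk0]; ring

/-! ### Measurability of the curve, its density and its velocity in time. -/

theorem exists_tendsto_indicator {s : Set (EucSp d)} (hs : IsOpen s) (hb : Bornology.IsBounded s) :
    ∃ φ : ℕ → EucSp d → ℝ, (∀ n, ContDiff ℝ 1 (φ n)) ∧ (∀ n, HasCompactSupport (φ n)) ∧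
      (∀ n x, ‖φ n x‖ ≤ 1) ∧
      ∀ x, Tendsto (fun n => φ n x) atTop (𝓝 (s.indicator (fun _ => (1 : ℝ)) x)) := by
  obtain ⟨f, hf, hfc, hfr⟩ := hs.exists_contDiff_support_eq (n := 1)
  refine ⟨fun n x => Real.smoothTransition (n * f x), fun n => ?_, fun n => ?_, fun n x => ?_,
    fun x => ?_⟩
  · exact Real.smoothTransition.contDiff.comp (contDiff_const.mul hfc)
  · refine HasCompactSupport.of_support_subset_isCompact hb.isCompact_closure fun x hx => ?_
    refine subset_closure (hf ▸ ?_)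
    rw [Function.mem_support] at hx ⊢
    contrapose! hx
    rw [hx, mul_zero, Real.smoothTransition.zero]
  · rw [Real.norm_of_nonneg (Real.smoothTransition.nonneg _)]
    exact Real.smoothTransition.le_one _
  · by_cases hx : x ∈ s
    · have h0 : f x ≠ 0 := by rw [← hf] at hx; exact hx
      have hpos : 0 < f x := lt_of_le_of_ne (hfr (mem_range_self x)).1 h0.symm
      rw [indicator_of_mem hx]
      refine tendsto_const_nhds.congr' ?_
      have := (tendsto_natCast_atTop_atTop (R := ℝ)).atTop_mul_const hpos
      filter_upwards [this.eventually_ge_atTop 1] with n hn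
      exact (Real.smoothTransition.one_of_one_le hn).symm
    · have h0 : f x = 0 := by rw [← hf] at hx; simpa using hx
      simp [hx, h0, Real.smoothTransition.zero]

theorem borel_eq_generateFrom_isOpen_isBounded :
    (inferInstance : MeasurableSpace (EucSp d)) =
      MeasurableSpace.generateFrom {s | IsOpen s ∧ Bornology.IsBounded s} := by
  rw [BorelSpace.measurable_eq (α := EucSp d)]
  refine le_antisymm (MeasurableSpace.generateFrom_le fun s hs => ?_)
    (MeasurableSpace.generateFrom_le fun s hs => MeasurableSpace.measurableSet_generateFrom hs.1)
  have : s = ⋃ n : ℕ, s ∩ Metric.ball 0 n := by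
    rw [← inter_iUnion, Metric.iUnion_ball_nat, inter_univ]
  rw [this]
  refine MeasurableSet.iUnion fun n => MeasurableSpace.measurableSet_generateFrom
    ⟨IsOpen.inter hs Metric.isOpen_ball, Metric.isBounded_ball.subset inter_subset_right⟩

/-- Bounded open sets form a π-system generating the Borel sets, and their indicators are limits of
`C^1_c` functions. Measurability of `t ↦ μ_t` thus follows from continuity against such functions.
Outside `[0,1]` a Dirac mass is put in place of the uncontrolled values. -/
theorem exists_kernel_eq_on_Icc {μ : ℝ → Measure (EucSp d)}
    (hprob : ∀ t ∈ Icc (0 : ℝ) 1, IsProbabilityMeasure (μ t))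
    (hcont : ∀ φ : EucSp d → ℝ, ContDiff ℝ 1 φ → HasCompactSupport φ →
      ContinuousOn (fun t => ∫ x, φ x ∂μ t) (Icc 0 1)) :
    ∃ κ : ProbabilityTheory.Kernel ℝ (EucSp d), ProbabilityTheory.IsMarkovKernel κ ∧
      ∀ t ∈ Icc (0 : ℝ) 1, κ t = μ t := by
  classical
  set m : ℝ → Measure (EucSp d) := fun t => if t ∈ Icc (0 : ℝ) 1 then μ t else Measure.dirac 0
    with hm
  have hmI : ∀ t ∈ Icc (0 : ℝ) 1, m t = μ t := fun t ht => if_pos ht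
  have hmp : ∀ t, IsProbabilityMeasure (m t) := by
    intro t
    by_cases ht : t ∈ Icc (0 : ℝ) 1
    · rw [hmI t ht]; exact hprob t ht
    · simp only [hm, if_neg ht]; infer_instance
  have hφ : ∀ φ : EucSp d → ℝ, ContDiff ℝ 1 φ → HasCompactSupport φ →
      Measurable fun t => ∫ x, φ x ∂m t := by
    intro φ h1 h2
    have : (fun t => ∫ x, φ x ∂m t) =
        (Icc (0 : ℝ) 1).piecewise (fun t => ∫ x, φ x ∂μ t) fun _ => φ 0 := by
      ext t
      by_cases ht : t ∈ Icc (0 : ℝ) 1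
      · rw [piecewise_eq_of_mem _ _ _ ht, hmI t ht]
      · rw [piecewise_eq_of_notMem _ _ _ ht]
        simp only [hm, if_neg ht, integral_dirac]
    rw [this]
    exact (hcont φ h1 h2).measurable_piecewise continuousOn_const measurableSet_Icc
  have hmeas : Measurable m := by
    refine Measurable.measure_of_isPiSystem_of_isProbabilityMeasure
      borel_eq_generateFrom_isOpen_isBounded ?_ ?_
    · intro s hs t ht _
      exact ⟨hs.1.inter ht.1, hs.2.subset inter_subset_left⟩
    · intro s hs
      obtain ⟨φ, h1, h2, h3, h4⟩ := exists_tendsto_indicator hs.1 hs.2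
      have hlim : Measurable fun t => (m t).real s := by
        refine measurable_of_tendsto_metrizable (f := fun n t => ∫ x, φ n x ∂m t)
          (fun n => hφ _ (h1 n) (h2 n)) ?_
        rw [tendsto_pi_nhds]
        intro t
        rw [← integral_indicator_one hs.1.measurableSet]
        refine tendsto_integral_of_dominated_convergence (fun _ => (1 : ℝ))
          (fun n => (h1 n).continuous.aestronglyMeasurable) (integrable_const _)
          (fun n => ae_of_all _ (h3 n)) (ae_of_all _ fun x => h4 x)
      simpa [Measure.real] using hlim.ennreal_ofReal
  exact ⟨⟨m, hmeas⟩, ⟨hmp⟩, hmI⟩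

/-- The kernel is differentiated with respect to a finite measure equivalent to Lebesgue measure,
which gives joint measurability; the chain rule then returns to Lebesgue measure. -/
theorem exists_measurable_density (κ : ProbabilityTheory.Kernel ℝ (EucSp d))
    [ProbabilityTheory.IsMarkovKernel κ] :
    ∃ u : ℝ → EucSp d → ℝ≥0∞, Measurable (Function.uncurry u) ∧
      MeasurableSet {t | κ t ≪ volume} ∧
      ∀ t, κ t ≪ volume → (κ t).rnDeriv volume =ᵐ[volume] u t := by
  set ν : Measure (EucSp d) := (volume : Measure (EucSp d)).toFinite with hν
  set η := ProbabilityTheory.Kernel.const ℝ ν with hη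
  have h1 : ν ≪ volume := toFinite_absolutelyContinuous _
  have h2 : volume ≪ ν := absolutelyContinuous_toFinite _
  refine ⟨fun t x => κ.rnDeriv η t x * ν.rnDeriv volume x, ?_, ?_, fun t ht => ?_⟩
  · exact (ProbabilityTheory.Kernel.measurable_rnDeriv κ η).mul
      ((Measure.measurable_rnDeriv _ _).comp measurable_snd)
  · have := ProbabilityTheory.Kernel.measurableSet_absolutelyContinuous κ η
    convert this using 3 with t
    exact ⟨fun h => h.trans h2, fun h => h.trans h1⟩
  · have ha : κ.rnDeriv η t =ᵐ[volume] (κ t).rnDeriv ν :=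
      h2.ae_le (ProbabilityTheory.Kernel.rnDeriv_eq_rnDeriv_measure (κ := κ) (η := η) (a := t))
    have hb := Measure.rnDeriv_mul_rnDeriv (μ := κ t) (ν := ν) (κ := volume) (ht.trans h2)
    filter_upwards [ha, hb] with x hx hx'
    rw [← hx', Pi.mul_apply, hx]

theorem IsVelocityField.exists_measurable {p : ℝ} {Ω : Set (EucSp d)} {μ : ℝ → Measure (EucSp d)}
    {v : ℝ → EucSp d → EucSp d} (hΩ : MeasurableSet Ω) (hv : IsVelocityField p Ω μ v) :
    ∃ w : ℝ → EucSp d → EucSp d, Measurable (Function.uncurry w) ∧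
      ∀ t ∈ Icc (0 : ℝ) 1, ∀ x ∈ Ω, w t x = v t x := by
  classical
  have hS : MeasurableSet (Icc (0 : ℝ) 1 ×ˢ Ω) := measurableSet_Icc.prod hΩ
  refine ⟨fun t x => (Icc (0 : ℝ) 1 ×ˢ Ω).indicator (Function.uncurry v) (t, x), ?_,
    fun t ht x hx => indicator_of_mem (s := Icc (0 : ℝ) 1 ×ˢ Ω) ⟨ht, hx⟩ _⟩
  refine measurable_of_restrict_of_restrict_compl hS ?_ ?_
  · convert hv.measurable using 1
    ext1 ⟨z, hz⟩
    exact indicator_of_mem hz _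
  · convert (measurable_const : Measurable fun _ => (0 : EucSp d)) using 1
    ext1 ⟨z, hz⟩
    exact indicator_of_notMem hz _

/-- The continuity equation exhibits the function as a constant plus the primitive of an integrable
function. -/
theorem IsVelocityField.continuousOn_integral {p : ℝ} {Ω : Set (EucSp d)}
    {μ : ℝ → Measure (EucSp d)} {v : ℝ → EucSp d → EucSp d} (hv : IsVelocityField p Ω μ v)
    {φ : EucSp d → ℝ} (h1 : ContDiff ℝ 1 φ) (h2 : HasCompactSupport φ) :
    ContinuousOn (fun t => ∫ x, φ x ∂μ t) (Icc 0 1) := by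
  have hint := hv.integrable φ h1 h2
  have h : ∀ t ∈ Icc (0 : ℝ) 1, ∫ x, φ x ∂μ t =
      ∫ x, φ x ∂μ 0 + ∫ s in (0 : ℝ)..t, ∫ x, fderiv ℝ φ x (v s x) ∂μ s := by
    intro t ht
    rcases ht.1.eq_or_lt with rfl | h0
    · simp
    · rw [← hv.continuity_eq φ h1 h2 0 (by simp) t ht h0]; ring
  refine ContinuousOn.congr ?_ h
  refine continuousOn_const.add ?_
  have := intervalIntegral.continuousOn_primitive_interval (a := (0 : ℝ)) (b := 1)
    (f := fun s => ∫ x, fderiv ℝ φ x (v s x) ∂μ s) (μ := volume)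
    (by rwa [uIcc_of_le zero_le_one])
  rwa [uIcc_of_le zero_le_one] at this

/-! ### The perturbation `id + ε ξ`. -/

theorem fderiv_slice {ξ : ℝ → EucSp d → EucSp d} (hξ : ContDiff ℝ ∞ (Function.uncurry ξ))
    (t : ℝ) (x : EucSp d) :
    fderiv ℝ (ξ t) x = (fderiv ℝ (Function.uncurry ξ) (t, x)).comp
      (ContinuousLinearMap.inr ℝ ℝ (EucSp d)) := by
  have h := (hξ.differentiable (by simp) (t, x)).hasFDerivAt.comp x (hasFDerivAt_prodMk_right t x)
  exact h.fderiv

theorem hasDerivAt_slice {ξ : ℝ → EucSp d → EucSp d} (hξ : ContDiff ℝ ∞ (Function.uncurry ξ))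
    (t : ℝ) (x : EucSp d) :
    HasDerivAt (fun s => ξ s x) (fderiv ℝ (Function.uncurry ξ) (t, x) (1, 0)) t := by
  have h := (hξ.differentiable (by simp) (t, x)).hasFDerivAt.comp t
    (hasFDerivAt_prodMk_left (𝕜 := ℝ) t x)
  have h' := h.hasDerivAt
  rwa [ContinuousLinearMap.comp_apply, ContinuousLinearMap.inl_apply] at h'

theorem differentiable_slice {ξ : ℝ → EucSp d → EucSp d}
    (hξ : ContDiff ℝ ∞ (Function.uncurry ξ)) (t : ℝ) : Differentiable ℝ (ξ t) := fun x =>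
  ((hξ.differentiable (by simp) (t, x)).hasFDerivAt.comp x
    (hasFDerivAt_prodMk_right t x)).differentiableAt

theorem continuous_fderiv_slice {ξ : ℝ → EucSp d → EucSp d}
    (hξ : ContDiff ℝ ∞ (Function.uncurry ξ)) :
    Continuous fun z : ℝ × EucSp d => fderiv ℝ (ξ z.1) z.2 := by
  simp_rw [fderiv_slice hξ]
  exact (hξ.continuous_fderiv (by simp)).clm_comp continuous_const

theorem continuous_deriv_slice {ξ : ℝ → EucSp d → EucSp d}
    (hξ : ContDiff ℝ ∞ (Function.uncurry ξ)) :
    Continuous fun z : ℝ × EucSp d => deriv (fun s => ξ s z.2) z.1 := by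
  simp_rw [fun z : ℝ × EucSp d => (hasDerivAt_slice hξ z.1 z.2).deriv]
  exact (hξ.continuous_fderiv (by simp)).clm_apply continuous_const

theorem exists_bound_slice {ξ : ℝ → EucSp d → EucSp d} (hξ : ContDiff ℝ ∞ (Function.uncurry ξ))
    (hs : HasCompactSupport (Function.uncurry ξ)) :
    ∃ M > 0, ∀ t x, ‖fderiv ℝ (ξ t) x‖ ≤ M ∧ ‖deriv (fun s => ξ s x) t‖ ≤ M := by
  have hc : Continuous (fderiv ℝ (Function.uncurry ξ)) := hξ.continuous_fderiv (by simp)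
  have hcs : HasCompactSupport (fderiv ℝ (Function.uncurry ξ)) := hs.fderiv ℝ
  obtain ⟨C, hC⟩ := hcs.exists_bound_of_continuous hc
  have hC0 : 0 ≤ C := (norm_nonneg _).trans (hC 0)
  refine ⟨C + 1, by linarith, fun t x => ⟨?_, ?_⟩⟩
  · rw [fderiv_slice hξ]
    calc _ ≤ ‖fderiv ℝ (Function.uncurry ξ) (t, x)‖ * ‖ContinuousLinearMap.inr ℝ ℝ (EucSp d)‖ :=
          ContinuousLinearMap.opNorm_comp_le _ _
      _ ≤ C * 1 := by
          gcongr
          · exact hC _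
          · exact ContinuousLinearMap.norm_inr_le_one ℝ ℝ (EucSp d)
      _ ≤ _ := by linarith
  · rw [(hasDerivAt_slice hξ t x).deriv]
    calc _ ≤ ‖fderiv ℝ (Function.uncurry ξ) (t, x)‖ * ‖((1 : ℝ), (0 : EucSp d))‖ :=
          ContinuousLinearMap.le_opNorm _ _
      _ ≤ C * 1 := by
          gcongr
          · exact hC _
          · simp [Prod.norm_def]
      _ ≤ _ := by linarith

theorem hasFDerivAt_perturb {ξ : ℝ → EucSp d → EucSp d} (hξ : ContDiff ℝ ∞ (Function.uncurry ξ))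
    (ε t : ℝ) (x : EucSp d) :
    HasFDerivAt (perturb ξ ε t) (ContinuousLinearMap.id ℝ (EucSp d) + ε • fderiv ℝ (ξ t) x) x :=
  (hasFDerivAt_id x).add ((differentiable_slice hξ t x).hasFDerivAt.const_smul ε)

/-- The field is affine in `ε`, so at each point the kinetic integrand is the `p`-th power of the
norm along a straight line. -/
theorem lagrangianField_perturb {ξ v : ℝ → EucSp d → EucSp d}
    (hξ : ContDiff ℝ ∞ (Function.uncurry ξ)) (ε t : ℝ) (x : EucSp d) :
    lagrangianField (perturb ξ ε) v t x = v t x + ε • lagrangianField ξ v t x := by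
  have h1 : HasDerivAt (fun s => perturb ξ ε s x) (ε • deriv (fun s => ξ s x) t) t :=
    ((hasDerivAt_slice hξ t x).differentiableAt.hasDerivAt.const_smul ε).const_add x
  rw [lagrangianField, (hasFDerivAt_perturb hξ ε t x).fderiv, h1.deriv, lagrangianField, smul_add,
    ← add_assoc]
  rfl

theorem exists_homeomorph_perturb {ξ : ℝ → EucSp d → EucSp d}
    (hξ : ContDiff ℝ ∞ (Function.uncurry ξ)) {M : ℝ} {t : ℝ}
    (hM : ∀ x, ‖fderiv ℝ (ξ t) x‖ ≤ M) {ε : ℝ} (hε : |ε| * M < 1) :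
    ∃ e : EucSp d ≃ₜ EucSp d, perturb ξ ε t = e := by
  have hM0 : 0 ≤ M := (norm_nonneg _).trans (hM 0)
  have hc : (NNReal.mk (|ε| * M) (by positivity)) < 1 := hε
  obtain ⟨e, he⟩ := exists_homeomorph_id_add (fun x => ε • ξ t x) hc (by
    refine lipschitzWith_of_nnnorm_fderiv_le (𝕜 := ℝ) ((differentiable_slice hξ t).const_smul ε)
      fun x => ?_
    have := ((differentiable_slice hξ t x).hasFDerivAt.const_smul ε).fderiv
    change ‖fderiv ℝ (ε • ξ t) x‖ ≤ |ε| * M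
    rw [this, norm_smul, Real.norm_eq_abs]
    gcongr
    exact hM x)
  exact ⟨e, funext fun x => (he x).symm⟩

theorem norm_lagrangianField_le {ξ v : ℝ → EucSp d → EucSp d} {M t : ℝ} {x : EucSp d}
    (h1 : ‖fderiv ℝ (ξ t) x‖ ≤ M) (h2 : ‖deriv (fun s => ξ s x) t‖ ≤ M) :
    ‖lagrangianField ξ v t x‖ ≤ M * (‖v t x‖ + 1) :=
  calc _ ≤ ‖fderiv ℝ (ξ t) x (v t x)‖ + ‖deriv (fun s => ξ s x) t‖ := norm_add_le _ _
    _ ≤ M * ‖v t x‖ + M := by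
        gcongr; exact (ContinuousLinearMap.le_opNorm _ _).trans (by gcongr)
    _ = _ := by ring

theorem aestronglyMeasurable_lagrangianField {ξ v : ℝ → EucSp d → EucSp d}
    (hξ : ContDiff ℝ ∞ (Function.uncurry ξ)) {t : ℝ} {m : Measure (EucSp d)}
    (hv : AEStronglyMeasurable (v t) m) : AEStronglyMeasurable (lagrangianField ξ v t) m := by
  refine AEStronglyMeasurable.add ?_ ?_
  · have h1 : Continuous fun x => fderiv ℝ (ξ t) x :=
      (continuous_fderiv_slice hξ).comp (Continuous.prodMk_right t)
    exact (isBoundedBilinearMap_apply (𝕜 := ℝ) (E := EucSp d)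
      (F := EucSp d)).continuous.comp_aestronglyMeasurable
      (h1.aestronglyMeasurable.prodMk hv)
  · exact ((continuous_deriv_slice hξ).comp (Continuous.prodMk_right t)).aestronglyMeasurable

theorem Lq_pushCurve_perturb {ξ : ℝ → EucSp d → EucSp d} {μ : ℝ → Measure (EucSp d)}
    (hξ : ContDiff ℝ ∞ (Function.uncurry ξ)) {M : ℝ} {t q ε : ℝ} (hq : 1 < q)
    (hM : ∀ x, ‖fderiv ℝ (ξ t) x‖ ≤ M) (hε : |ε| * M < 1) [IsProbabilityMeasure (μ t)]
    (hac : μ t ≪ volume)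
    (hdet : ∀ x, (ContinuousLinearMap.id ℝ (EucSp d) + ε • fderiv ℝ (ξ t) x).det ≠ 0) :
    Lq q (pushCurve (perturb ξ ε) μ t) = ∫⁻ x, (μ t).rnDeriv volume x ^ q *
      ENNReal.ofReal (detPow q (ε • fderiv ℝ (ξ t) x)) := by
  obtain ⟨e, he⟩ := exists_homeomorph_perturb hξ hM hε
  rw [pushCurve, he]
  refine Lq_map_homeomorph hq hac e (fun x => he ▸ hasFDerivAt_perturb hξ ε t x) hdet ?_
  refine (contDiff_det_id_add (d := d)).continuous.measurable.comp ?_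
  exact (((continuous_fderiv_slice hξ).comp (Continuous.prodMk_right t)).const_smul ε).measurable

theorem kinetic_pushCurve_perturb {ξ v : ℝ → EucSp d → EucSp d} {μ : ℝ → Measure (EucSp d)}
    (hξ : ContDiff ℝ ∞ (Function.uncurry ξ)) {M : ℝ} {t p ε : ℝ}
    (hM : ∀ x, ‖fderiv ℝ (ξ t) x‖ ≤ M ∧ ‖deriv (fun s => ξ s x) t‖ ≤ M) (hε : |ε| * M < 1)
    [IsProbabilityMeasure (μ t)] (hv : Integrable (v t) (μ t)) :
    kinetic p (pushCurve (perturb ξ ε) μ) (transportedField (perturb ξ ε) μ v) t =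
      ∫⁻ x, ‖v t x + ε • lagrangianField ξ v t x‖ₑ ^ p ∂μ t := by
  obtain ⟨e, he⟩ := exists_homeomorph_perturb hξ (fun x => (hM x).1) hε
  have hl : Integrable (lagrangianField ξ v t) (μ t) := by
    refine ((hv.norm.add (integrable_const 1)).const_mul M).mono'
      (aestronglyMeasurable_lagrangianField hξ hv.aestronglyMeasurable)
      (ae_of_all _ fun x => norm_lagrangianField_le (hM x).1 (hM x).2)
  rw [kinetic_pushCurve e he ?_]
  · simp_rw [lagrangianField_perturb hξ]
  · exact (hv.add (hl.smul ε)).congr (ae_of_all _ fun x => (lagrangianField_perturb hξ ε t x).symm)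

/-! ### The two energies at a fixed time. -/

theorem integrable_norm_rpow_and_kinetic {p : ℝ} (hp : 1 < p) {m : Measure (EucSp d)}
    {f : EucSp d → EucSp d} (hf : MemLp f (ENNReal.ofReal p) m) :
    Integrable (fun x => ‖f x‖ ^ p) m ∧
      ∫⁻ x, ‖f x‖ₑ ^ p ∂m = ENNReal.ofReal (∫ x, ‖f x‖ ^ p ∂m) := by
  have h1 : Integrable (fun x => ‖f x‖ ^ p) m := by
    have := hf.integrable_norm_rpow (by simp; linarith) ENNReal.ofReal_ne_top
    rwa [ENNReal.toReal_ofReal (by linarith)] at this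
  refine ⟨h1, ?_⟩
  rw [ofReal_integral_eq_lintegral_ofReal h1 (ae_of_all _ fun x => by positivity)]
  refine lintegral_congr fun x => ?_
  rw [← ENNReal.ofReal_rpow_of_nonneg (norm_nonneg _) (by linarith), ofReal_norm]

theorem Lq_eq_ofReal_integral {q : ℝ} (hq : 1 < q) {m : Measure (EucSp d)} [IsFiniteMeasure m]
    (hac : m ≪ volume) (hL : Lq q m < ⊤) :
    Integrable (fun x => (m.rnDeriv volume x).toReal ^ q) ∧
      Lq q m = ENNReal.ofReal (∫ x, (m.rnDeriv volume x).toReal ^ q) := by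
  rw [Lq, if_pos hac] at hL ⊢
  have hm : Measurable fun x => m.rnDeriv volume x ^ q := (Measure.measurable_rnDeriv _ _).pow_const q
  have h1 : Integrable (fun x => (m.rnDeriv volume x).toReal ^ q) := by
    have := integrable_toReal_of_lintegral_ne_top hm.aemeasurable hL.ne
    exact this.congr (ae_of_all _ fun x => (ENNReal.toReal_rpow _ _).symm)
  refine ⟨h1, ?_⟩
  rw [ofReal_integral_eq_lintegral_ofReal h1 (ae_of_all _ fun x => by positivity)]
  refine lintegral_congr_ae ?_
  filter_upwards [m.rnDeriv_lt_top volume] with x hx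
  rw [← ENNReal.ofReal_rpow_of_nonneg ENNReal.toReal_nonneg (by linarith),
    ENNReal.ofReal_toReal hx.ne]

/-- The integrand `u^q` times `detPow` is Lipschitz in `ε` with constant `C u^q`, which integrates
to `C L_q(μ_t)`. The constants precede `μ` and `t`: this uniformity is what the integration in time
requires. -/
theorem internal_energy_perturbation {ξ : ℝ → EucSp d → EucSp d} {M q : ℝ} (hM : 0 < M)
    (hq : 1 < q) (hξ : ContDiff ℝ ∞ (Function.uncurry ξ))
    (hb : ∀ t x, ‖fderiv ℝ (ξ t) x‖ ≤ M) :
    ∃ δ > 0, ∃ C > 0, ∀ (μ : ℝ → Measure (EucSp d)) (t : ℝ), IsProbabilityMeasure (μ t) →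
      μ t ≪ volume → Lq q (μ t) < ⊤ →
      0 < (Lq q (μ t)).toReal ∧
      (∀ ε ∈ Metric.ball (0 : ℝ) δ, Lq q (pushCurve (perturb ξ ε) μ t) < ⊤ ∧
        Lq q (pushCurve (perturb ξ ε) μ t) = ∫⁻ x, (μ t).rnDeriv volume x ^ q *
          ENNReal.ofReal (detPow q (ε • fderiv ℝ (ξ t) x))) ∧
      (∀ ε ∈ Metric.ball (0 : ℝ) δ, ∀ ε' ∈ Metric.ball (0 : ℝ) δ,
        |(Lq q (pushCurve (perturb ξ ε) μ t)).toReal -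
          (Lq q (pushCurve (perturb ξ ε') μ t)).toReal| ≤ C * (Lq q (μ t)).toReal * |ε - ε'|) ∧
      Integrable (pressureDensity q μ ξ t) ∧
      HasDerivAt (fun ε => (Lq q (pushCurve (perturb ξ ε) μ t)).toReal)
        ((1 - q) * ∫ x, pressureDensity q μ ξ t x) 0 := by
  obtain ⟨δ₁, hδ₁, C, hC, hA⟩ := exists_detPow_lipschitz (d := d) q M hM
  refine ⟨min δ₁ (1 / M), by positivity, C, hC, fun μ t hprob hac hL => ?_⟩
  obtain ⟨hint, hLeq⟩ := Lq_eq_ofReal_integral hq hac hL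
  set w : EucSp d → ℝ := fun x => ((μ t).rnDeriv volume x).toReal ^ q with hw
  have hw0 : ∀ x, 0 ≤ w x := fun x => by positivity
  have hwI : (Lq q (μ t)).toReal = ∫ x, w x := by
    rw [hLeq, ENNReal.toReal_ofReal (integral_nonneg hw0)]
  set δ := min δ₁ (1 / M) with hδdef
  have hδ : 0 < δ := by positivity
  have hsub : Metric.ball (0 : ℝ) δ ⊆ Metric.ball 0 δ₁ := Metric.ball_subset_ball (min_le_left _ _)
  have hsm : ∀ ε ∈ Metric.ball (0 : ℝ) δ, |ε| * M < 1 := by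
    intro ε hε
    rw [Metric.mem_ball, dist_zero_right, Real.norm_eq_abs] at hε
    have := hε.trans_le (min_le_right _ _)
    rwa [lt_div_iff₀ hM] at this
  have hform : ∀ ε ∈ Metric.ball (0 : ℝ) δ, Lq q (pushCurve (perturb ξ ε) μ t) =
      ∫⁻ x, (μ t).rnDeriv volume x ^ q * ENNReal.ofReal (detPow q (ε • fderiv ℝ (ξ t) x)) :=
    fun ε hε => Lq_pushCurve_perturb hξ hq (hb t) (hsm ε hε) hac
      fun x => (hA _ (hb t x)).1 ε (hsub hε)
  have hfc : Continuous fun x => fderiv ℝ (ξ t) x :=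
    (continuous_fderiv_slice hξ).comp (Continuous.prodMk_right t)
  have hz : ∀ x, detPow q ((0 : ℝ) • fderiv ℝ (ξ t) x) = 1 := fun x => by
    rw [show (0 : ℝ) • fderiv ℝ (ξ t) x = 0 from zero_smul ℝ (fderiv ℝ (ξ t) x), detPow_zero]
  have hpr : ∀ x, (1 - q) * pressureDensity q μ ξ t x =
      w x * ((1 - q) * ∑ i, fderiv ℝ (ξ t) x (EuclideanSpace.single i 1) i) := fun x => by
    simp only [pressureDensity, divergence, hw]; ring
  have key := hasDerivAt_integral_of_abs_sub_le (m := (volume : Measure (EucSp d)))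
    (f := fun ε x => w x * detPow q (ε • fderiv ℝ (ξ t) x))
    (f' := fun x => (1 - q) * pressureDensity q μ ξ t x) (bound := fun x => C * w x) hδ
    (fun ε _ => hint.aestronglyMeasurable.mul
      ((measurable_detPow q).comp (hfc.const_smul ε).measurable).aestronglyMeasurable)
    (by simpa only [hz, mul_one] using hint) (hint.const_mul C)
    (ae_of_all _ fun x ε hε ε' hε' => by
      rw [← mul_sub, abs_mul, abs_of_nonneg (hw0 x)]
      calc _ ≤ w x * (C * |ε - ε'|) := by
            exact mul_le_mul_of_nonneg_left
              ((hA _ (hb t x)).2 ε (hsub hε) ε' (hsub hε')) (hw0 x)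
        _ = _ := by ring)
    (ae_of_all _ fun x => by
      rw [hpr]
      exact (hasDerivAt_detPow_smul q (fderiv ℝ (ξ t) x)).const_mul (w x))
  obtain ⟨k1, k2, k3, k4⟩ := key
  have hreal : ∀ ε ∈ Metric.ball (0 : ℝ) δ, Lq q (pushCurve (perturb ξ ε) μ t) =
      ENNReal.ofReal (∫ x, w x * detPow q (ε • fderiv ℝ (ξ t) x)) := by
    intro ε hε
    rw [hform ε hε, ofReal_integral_eq_lintegral_ofReal (k1 ε hε)
      (ae_of_all _ fun x => mul_nonneg (hw0 x) (detPow_nonneg _ _))]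
    refine lintegral_congr_ae ?_
    filter_upwards [(μ t).rnDeriv_lt_top volume] with x hx
    rw [ENNReal.ofReal_mul (hw0 x), hw,
      ← ENNReal.ofReal_rpow_of_nonneg ENNReal.toReal_nonneg (by linarith),
      ENNReal.ofReal_toReal hx.ne]
  have hreal' : ∀ ε ∈ Metric.ball (0 : ℝ) δ, (Lq q (pushCurve (perturb ξ ε) μ t)).toReal =
      ∫ x, w x * detPow q (ε • fderiv ℝ (ξ t) x) := by
    intro ε hε
    rw [hreal ε hε, ENNReal.toReal_ofReal
      (integral_nonneg fun x => mul_nonneg (hw0 x) (detPow_nonneg _ _))]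
  refine ⟨?_, fun ε hε => ⟨hreal ε hε ▸ ENNReal.ofReal_lt_top, hform ε hε⟩, ?_, ?_, ?_⟩
  -- If the energy vanished, so would the density, contradicting total mass `1`.
  · refine ENNReal.toReal_pos ?_ hL.ne
    intro h0
    rw [Lq, if_pos hac, lintegral_eq_zero_iff ((Measure.measurable_rnDeriv _ _).pow_const q)] at h0
    have h1 : ∫⁻ x, (μ t).rnDeriv volume x = 0 := by
      rw [lintegral_eq_zero_iff (Measure.measurable_rnDeriv _ _)]
      filter_upwards [h0] with x hx
      have hx' : (μ t).rnDeriv volume x ^ q = 0 := hx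
      rcases ENNReal.rpow_eq_zero_iff.1 hx' with h | h
      · exact h.1
      · linarith [h.2]
    rw [Measure.lintegral_rnDeriv hac, measure_univ] at h1
    exact one_ne_zero h1
  · intro ε hε ε' hε'
    rw [hreal' ε hε, hreal' ε' hε', hwI, ← integral_const_mul]
    exact k4 ε hε ε' hε'
  · have := k2.const_mul (1 - q)⁻¹
    refine this.congr (ae_of_all _ fun x => ?_)
    have : 1 - q ≠ 0 := by linarith
    field_simp
  · rw [← integral_const_mul]
    refine k3.congr_of_eventuallyEq ?_
    filter_upwards [Metric.ball_mem_nhds (0 : ℝ) hδ] with ε hε using hreal' ε hε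

theorem kinetic_energy_perturbation {ξ : ℝ → EucSp d → EucSp d} {M p V₀ : ℝ} (hM : 0 < M)
    (hp : 1 < p) (hV₀ : 0 < V₀) (hξ : ContDiff ℝ ∞ (Function.uncurry ξ))
    (hb : ∀ t x, ‖fderiv ℝ (ξ t) x‖ ≤ M ∧ ‖deriv (fun s => ξ s x) t‖ ≤ M) :
    ∃ δ > 0, ∃ C > 0, ∀ (μ : ℝ → Measure (EucSp d)) (v : ℝ → EucSp d → EucSp d) (t : ℝ),
      IsProbabilityMeasure (μ t) → MemLp (v t) (ENNReal.ofReal p) (μ t) →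
      ENNReal.ofReal V₀ ≤ kinetic p μ v t →
      kinetic p μ v t < ⊤ ∧ 0 < (kinetic p μ v t).toReal ∧
      (∀ ε ∈ Metric.ball (0 : ℝ) δ,
        kinetic p (pushCurve (perturb ξ ε) μ) (transportedField (perturb ξ ε) μ v) t < ⊤ ∧
        kinetic p (pushCurve (perturb ξ ε) μ) (transportedField (perturb ξ ε) μ v) t =
          ∫⁻ x, ‖v t x + ε • lagrangianField ξ v t x‖ₑ ^ p ∂μ t) ∧
      (∀ ε ∈ Metric.ball (0 : ℝ) δ, ∀ ε' ∈ Metric.ball (0 : ℝ) δ,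
        |(kinetic p (pushCurve (perturb ξ ε) μ) (transportedField (perturb ξ ε) μ v) t).toReal -
          (kinetic p (pushCurve (perturb ξ ε') μ)
            (transportedField (perturb ξ ε') μ v) t).toReal| ≤
          C * (kinetic p μ v t).toReal * |ε - ε'|) ∧
      Integrable (kineticDensity p v ξ t) (μ t) ∧
      HasDerivAt (fun ε =>
          (kinetic p (pushCurve (perturb ξ ε) μ) (transportedField (perturb ξ ε) μ v) t).toReal)
        (p * ∫ x, kineticDensity p v ξ t x ∂μ t) 0 := by
  set c : ℝ := p * ((M + 1) ^ p * 2 ^ (p - 1)) with hc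
  have hc0 : 0 < c := by positivity
  refine ⟨min 1 (1 / M), by positivity, c * (1 + 1 / V₀), by positivity,
    fun μ v t hprob hv hVt => ?_⟩
  obtain ⟨hint, hkin⟩ := integrable_norm_rpow_and_kinetic hp hv
  have hV : kinetic p μ v t < ⊤ := by rw [kinetic, hkin]; exact ENNReal.ofReal_lt_top
  have hVI : (kinetic p μ v t).toReal = ∫ x, ‖v t x‖ ^ p ∂μ t := by
    rw [kinetic, hkin, ENNReal.toReal_ofReal (integral_nonneg fun x => by positivity)]
  have hVge : V₀ ≤ (kinetic p μ v t).toReal := (ENNReal.ofReal_le_iff_le_toReal hV.ne).1 hVt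
  have hv1 : Integrable (v t) (μ t) := hv.integrable (by simpa using hp.le)
  set g := lagrangianField ξ v t with hg
  have hgm : AEStronglyMeasurable g (μ t) :=
    aestronglyMeasurable_lagrangianField hξ hv1.aestronglyMeasurable
  set δ := min 1 (1 / M) with hδdef
  have hδ : 0 < δ := by positivity
  have hsub : Metric.ball (0 : ℝ) δ ⊆ Metric.ball 0 1 := Metric.ball_subset_ball (min_le_left _ _)
  have hsm : ∀ ε ∈ Metric.ball (0 : ℝ) δ, |ε| * M < 1 := by
    intro ε hε
    rw [Metric.mem_ball, dist_zero_right, Real.norm_eq_abs] at hε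
    have := hε.trans_le (min_le_right _ _)
    rwa [lt_div_iff₀ hM] at this
  have hform : ∀ ε ∈ Metric.ball (0 : ℝ) δ,
      kinetic p (pushCurve (perturb ξ ε) μ) (transportedField (perturb ξ ε) μ v) t =
        ∫⁻ x, ‖v t x + ε • g x‖ₑ ^ p ∂μ t :=
    fun ε hε => kinetic_pushCurve_perturb hξ (hb t) (hsm ε hε) hv1
  have hbnd : Integrable (fun x => c * (‖v t x‖ ^ p + 1)) (μ t) :=
    (hint.add (integrable_const 1)).const_mul c
  have key := hasDerivAt_integral_of_abs_sub_le (m := μ t)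
    (f := fun ε x => ‖v t x + ε • g x‖ ^ p)
    (f' := fun x => p * kineticDensity p v ξ t x) (bound := fun x => c * (‖v t x‖ ^ p + 1)) hδ
    (fun ε _ => ((hv1.aestronglyMeasurable.add (hgm.const_smul ε)).norm.aemeasurable.pow_const
      p).aestronglyMeasurable)
    (by simpa using hint) hbnd
    (ae_of_all _ fun x ε hε ε' hε' => by
      refine (abs_norm_rpow_sub_le hp hM.le (v t x) (g x)
        (norm_lagrangianField_le (hb t x).1 (hb t x).2) ε (hsub hε) ε' (hsub hε')).trans (le_of_eq ?_)
      rw [hc]; ring)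
    (ae_of_all _ fun x => by
      have := hasDerivAt_norm_add_smul_rpow hp (v t x) (g x) 0
      rw [zero_smul, add_zero] at this
      exact this)
  obtain ⟨k1, k2, k3, k4⟩ := key
  have hreal : ∀ ε ∈ Metric.ball (0 : ℝ) δ,
      kinetic p (pushCurve (perturb ξ ε) μ) (transportedField (perturb ξ ε) μ v) t =
        ENNReal.ofReal (∫ x, ‖v t x + ε • g x‖ ^ p ∂μ t) := by
    intro ε hε
    rw [hform ε hε, ofReal_integral_eq_lintegral_ofReal (k1 ε hε)
      (ae_of_all _ fun x => by positivity)]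
    refine lintegral_congr fun x => ?_
    rw [← ENNReal.ofReal_rpow_of_nonneg (norm_nonneg _) (by linarith), ofReal_norm]
  have hreal' : ∀ ε ∈ Metric.ball (0 : ℝ) δ,
      (kinetic p (pushCurve (perturb ξ ε) μ) (transportedField (perturb ξ ε) μ v) t).toReal =
        ∫ x, ‖v t x + ε • g x‖ ^ p ∂μ t := by
    intro ε hε
    rw [hreal ε hε, ENNReal.toReal_ofReal (integral_nonneg fun x => by positivity)]
  refine ⟨hV, hV₀.trans_le hVge, fun ε hε => ⟨hreal ε hε ▸ ENNReal.ofReal_lt_top, hform ε hε⟩,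
    ?_, ?_, ?_⟩
  · intro ε hε ε' hε'
    rw [hreal' ε hε, hreal' ε' hε']
    refine (k4 ε hε ε' hε').trans ?_
    rw [integral_const_mul, integral_add hint (integrable_const 1), ← hVI, integral_const,
      probReal_univ, one_smul]
    -- The pointwise bound integrates to `c (V + 1)`; the lower bound on `V` turns the `1` into a
    -- multiple of `V`.
    have h1 : 1 ≤ 1 / V₀ * (kinetic p μ v t).toReal := by
      rw [one_div_mul_eq_div, le_div_iff₀ hV₀]; linarith
    gcongr ?_ * _
    calc c * ((kinetic p μ v t).toReal + 1)
        ≤ c * ((1 + 1 / V₀) * (kinetic p μ v t).toReal) :=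
          mul_le_mul_of_nonneg_left (by linarith) hc0.le
      _ = _ := (mul_assoc _ _ _).symm
  · have := k2.const_mul p⁻¹
    refine this.congr (ae_of_all _ fun x => ?_)
    field_simp
  · rw [← integral_const_mul]
    refine k3.congr_of_eventuallyEq ?_
    filter_upwards [Metric.ball_mem_nhds (0 : ℝ) hδ] with ε hε using hreal' ε hε

/-! ### Measurability in time of the perturbed energies. -/

theorem measurable_lagrangianField {ξ w : ℝ → EucSp d → EucSp d}
    (hξ : ContDiff ℝ ∞ (Function.uncurry ξ)) (hw : Measurable (Function.uncurry w)) :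
    Measurable (Function.uncurry (lagrangianField ξ w)) := by
  refine Measurable.add (f := fun z : ℝ × EucSp d => fderiv ℝ (ξ z.1) z.2 (w z.1 z.2))
    (g := fun z : ℝ × EucSp d => deriv (fun s => ξ s z.2) z.1) ?_
    (continuous_deriv_slice hξ).measurable
  exact (isBoundedBilinearMap_apply (𝕜 := ℝ) (E := EucSp d)
    (F := EucSp d)).continuous.measurable.comp ((continuous_fderiv_slice hξ).measurable.prodMk hw)

theorem measurable_lintegral_detPow {ξ : ℝ → EucSp d → EucSp d}
    (hξ : ContDiff ℝ ∞ (Function.uncurry ξ)) {u : ℝ → EucSp d → ℝ≥0∞}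
    (hu : Measurable (Function.uncurry u)) (q ε : ℝ) :
    Measurable fun t => ∫⁻ x, u t x ^ q * ENNReal.ofReal (detPow q (ε • fderiv ℝ (ξ t) x)) := by
  refine Measurable.lintegral_prod_right'
    (f := fun z : ℝ × EucSp d => u z.1 z.2 ^ q *
      ENNReal.ofReal (detPow q (ε • fderiv ℝ (ξ z.1) z.2))) ?_
  exact (hu.pow_const q).mul ((measurable_detPow q).comp
    ((continuous_fderiv_slice hξ).const_smul ε).measurable).ennreal_ofReal

theorem measurable_lintegral_lagrangianField (κ : ProbabilityTheory.Kernel ℝ (EucSp d))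
    [ProbabilityTheory.IsMarkovKernel κ] {ξ w : ℝ → EucSp d → EucSp d}
    (hξ : ContDiff ℝ ∞ (Function.uncurry ξ)) (hw : Measurable (Function.uncurry w)) (p ε : ℝ) :
    Measurable fun t => ∫⁻ x, ‖w t x + ε • lagrangianField ξ w t x‖ₑ ^ p ∂κ t := by
  refine Measurable.lintegral_kernel_prod_right
    (f := fun t x => ‖w t x + ε • lagrangianField ξ w t x‖ₑ ^ p) ?_
  have h := (measurable_lagrangianField hξ hw).const_smul ε
  exact ((hw.add h).enorm.pow_const p)

theorem pushCurve_perturb_zero (ξ : ℝ → EucSp d → EucSp d) (μ : ℝ → Measure (EucSp d)) (t : ℝ) :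
    pushCurve (perturb ξ 0) μ t = μ t := by
  have : perturb ξ 0 t = id := by ext1 x; simp [perturb]
  rw [pushCurve, this, Measure.map_id]

theorem setIntegral_pressureDensity {q : ℝ} (hq : 1 < q) {Ω : Set (EucSp d)} (hΩ : MeasurableSet Ω)
    {μ : ℝ → Measure (EucSp d)} {t : ℝ} [IsFiniteMeasure (μ t)] (hac : μ t ≪ volume)
    (h0 : μ t Ωᶜ = 0) (ξ : ℝ → EucSp d → EucSp d) :
    ∫ x in Ω, pressureDensity q μ ξ t x = ∫ x, pressureDensity q μ ξ t x := by
  refine setIntegral_eq_integral_of_ae_compl_eq_zero ?_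
  have h1 : ∫⁻ x in Ωᶜ, (μ t).rnDeriv volume x = 0 := by
    rw [Measure.setLIntegral_rnDeriv hac, h0]
  rw [lintegral_eq_zero_iff (Measure.measurable_rnDeriv _ _)] at h1
  filter_upwards [(ae_restrict_iff' hΩ.compl).1 h1] with x hx hxΩ
  have hx' : (μ t).rnDeriv volume x = 0 := hx hxΩ
  rw [pressureDensity, hx', ENNReal.toReal_zero, Real.zero_rpow (by linarith), mul_zero]

end WeightedGeodesic

/-! ### Integration in time. -/

open WeightedGeodesic in
theorem mainTheorem3 {d : ℕ} (Ω : Set (EucSp d)) (hΩ_closed : IsClosed Ω) (hΩ_convex : Convex ℝ Ω)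
    (p q α β : ℝ) (hp : 1 < p) (hq : 1 < q) (hα : 0 < α)
    (μ : ℝ → Measure (EucSp d)) (hμ : WeightedGeodesic.IsLipschitzCurve p Ω μ)
    (v : ℝ → EucSp d → EucSp d) (hv : WeightedGeodesic.IsTangentField p Ω μ v)
    (hfin : WeightedGeodesic.energy p q α β μ v < ⊤)
    (V₀ : ℝ) (hV₀ : 0 < V₀)
    (hV : ∀ᵐ t ∂volume.restrict (Icc (0 : ℝ) 1),
      ENNReal.ofReal V₀ ≤ WeightedGeodesic.kinetic p μ v t)
    (ξ : ℝ → EucSp d → EucSp d) (hξ : ContDiff ℝ ∞ (Function.uncurry ξ))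
    (hξ_supp : HasCompactSupport (Function.uncurry ξ)) :
    (∀ᵐ t ∂volume.restrict (Icc (0 : ℝ) 1),
      μ t ≪ volume ∧ WeightedGeodesic.Lq q (μ t) < ⊤ ∧ WeightedGeodesic.kinetic p μ v t < ⊤ ∧
      IntegrableOn (WeightedGeodesic.pressureDensity q μ ξ t) Ω ∧
      Integrable (WeightedGeodesic.kineticDensity p v ξ t) (μ t)) ∧
    IntervalIntegrable (fun t =>
      (WeightedGeodesic.Lq q (μ t)).toReal ^ (α - 1) *
        (WeightedGeodesic.kinetic p μ v t).toReal ^ β *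
          ∫ x in Ω, WeightedGeodesic.pressureDensity q μ ξ t x) volume 0 1 ∧
    IntervalIntegrable (fun t =>
      (WeightedGeodesic.Lq q (μ t)).toReal ^ α *
        (WeightedGeodesic.kinetic p μ v t).toReal ^ (β - 1) *
          ∫ x, WeightedGeodesic.kineticDensity p v ξ t x ∂μ t) volume 0 1 ∧
    (∀ᶠ ε in 𝓝 (0 : ℝ), WeightedGeodesic.modifiedEnergy p q α β μ v ξ ε < ⊤) ∧
    HasDerivAt (fun ε : ℝ => (WeightedGeodesic.modifiedEnergy p q α β μ v ξ ε).toReal)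
      (α * (1 - q) * (∫ t in (0 : ℝ)..1,
          (WeightedGeodesic.Lq q (μ t)).toReal ^ (α - 1) *
            (WeightedGeodesic.kinetic p μ v t).toReal ^ β *
              ∫ x in Ω, WeightedGeodesic.pressureDensity q μ ξ t x) +
        p * β * (∫ t in (0 : ℝ)..1,
          (WeightedGeodesic.Lq q (μ t)).toReal ^ α *
            (WeightedGeodesic.kinetic p μ v t).toReal ^ (β - 1) *
              ∫ x, WeightedGeodesic.kineticDensity p v ξ t x ∂μ t)) 0 := by
  have hvel := hv.isVelocityField
  have hΩm : MeasurableSet Ω := hΩ_closed.measurableSet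
  set I : Measure ℝ := volume.restrict (Icc (0 : ℝ) 1) with hI
  have hmemI : ∀ᵐ t ∂I, t ∈ Icc (0 : ℝ) 1 := ae_restrict_mem measurableSet_Icc
  have hprob : ∀ t ∈ Icc (0 : ℝ) 1, IsProbabilityMeasure (μ t) := fun t ht =>
    (hμ.mem t ht).isProbabilityMeasure
  obtain ⟨κ, hκ, hκμ⟩ := exists_kernel_eq_on_Icc hprob
    fun φ h1 h2 => hvel.continuousOn_integral h1 h2
  obtain ⟨u, hu, hacm, huκ⟩ := exists_measurable_density κ
  obtain ⟨w, hw, hwv⟩ := hvel.exists_measurable hΩm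
  have hwae : ∀ t ∈ Icc (0 : ℝ) 1, ∀ᵐ x ∂μ t, w t x = v t x := fun t ht => by
    filter_upwards [measure_eq_zero_iff_ae_notMem.1 (hμ.mem t ht).compl_eq_zero] with x hx
    exact hwv t ht x (by simpa using hx)
  have hLm : AEMeasurable (fun t => Lq q (μ t)) I := by
    classical
    have h1 : Measurable fun t => if κ t ≪ volume then ∫⁻ x, u t x ^ q else ⊤ := by
      refine Measurable.ite hacm ?_ measurable_const
      exact Measurable.lintegral_prod_right' (f := fun z : ℝ × EucSp d => u z.1 z.2 ^ q)
        (hu.pow_const q)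
    refine ⟨_, h1, ?_⟩
    filter_upwards [hmemI] with t ht
    rw [hκμ t ht, Lq]
    split_ifs with h
    · rw [← hκμ t ht] at h ⊢
      exact lintegral_congr_ae ((huκ t h).fun_comp (· ^ q))
    · rfl
  have hkform : ∀ ε : ℝ, ∀ t ∈ Icc (0 : ℝ) 1,
      ∫⁻ x, ‖v t x + ε • lagrangianField ξ v t x‖ₑ ^ p ∂μ t =
        ∫⁻ x, ‖w t x + ε • lagrangianField ξ w t x‖ₑ ^ p ∂κ t := by
    intro ε t ht
    rw [hκμ t ht]
    refine lintegral_congr_ae ?_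
    filter_upwards [hwae t ht] with x hx
    rw [lagrangianField, lagrangianField, hx]
  have hKm : AEMeasurable (kinetic p μ v) I := by
    refine ⟨_, measurable_lintegral_lagrangianField κ hξ hw p 0, ?_⟩
    filter_upwards [hmemI] with t ht
    rw [← hkform 0 t ht, kinetic]
    simp
  have hfinae : ∀ᵐ t ∂I, Lq q (μ t) ^ α * kinetic p μ v t ^ β < ⊤ :=
    ae_lt_top' ((hLm.pow_const α).mul (hKm.pow_const β)) hfin.ne
  obtain ⟨M, hM, hb⟩ := exists_bound_slice hξ hξ_supp
  obtain ⟨δ₁, hδ₁, C₁, hC₁, hLq⟩ := internal_energy_perturbation hM hq hξ fun t x => (hb t x).1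
  obtain ⟨δ₂, hδ₂, C₂, hC₂, hkin⟩ := kinetic_energy_perturbation hM hp hV₀ hξ hb
  obtain ⟨δ₃, hδ₃, C₃, hC₃, hprod⟩ := exists_rpow_mul_rpow_lipschitz α β (max C₁ C₂)
    (lt_max_of_lt_left hC₁)
  set δ := min (min δ₁ δ₂) δ₃ with hδdef
  have hδ : 0 < δ := by positivity
  have hs1 : Metric.ball (0 : ℝ) δ ⊆ Metric.ball 0 δ₁ :=
    Metric.ball_subset_ball ((min_le_left _ _).trans (min_le_left _ _))
  have hs2 : Metric.ball (0 : ℝ) δ ⊆ Metric.ball 0 δ₂ :=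
    Metric.ball_subset_ball ((min_le_left _ _).trans (min_le_right _ _))
  have h0mem : (0 : ℝ) ∈ Metric.ball (0 : ℝ) δ := Metric.mem_ball_self hδ
  -- Since `V` is positive and finite, `V^β` is positive for either sign of `β`. Finiteness of `F^α
  -- V^β` with `α > 0` therefore forces `F < ∞`, and the value `⊤` of `Lq` on measures without
  -- density yields absolute continuity.
  have hgood : ∀ᵐ t ∂I, t ∈ Icc (0 : ℝ) 1 ∧ IsProbabilityMeasure (μ t) ∧ μ t ≪ volume ∧
      Lq q (μ t) < ⊤ ∧ MemLp (v t) (ENNReal.ofReal p) (μ t) ∧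
      ENNReal.ofReal V₀ ≤ kinetic p μ v t := by
    filter_upwards [hmemI, hV, hvel.memLp, hfinae] with t ht h1 h2 h3
    have hK := (hkin μ v t (hprob t ht) h2 h1).1
    have hK0 : kinetic p μ v t ≠ 0 := ((ENNReal.ofReal_pos.2 hV₀).trans_le h1).ne'
    have hL : Lq q (μ t) < ⊤ := by
      rw [lt_top_iff_ne_top]
      intro hL
      rw [hL, ENNReal.top_rpow_of_pos hα, ENNReal.top_mul] at h3
      · exact lt_irrefl _ h3
      · exact (ENNReal.rpow_pos (pos_iff_ne_zero.2 hK0) hK.ne).ne'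
    refine ⟨ht, hprob t ht, ?_, hL, h2, h1⟩
    by_contra hac
    rw [Lq, if_neg hac] at hL
    exact lt_irrefl _ hL
  set l : ℝ → ℝ → ℝ := fun ε t => (Lq q (pushCurve (perturb ξ ε) μ t)).toReal with hl
  set k : ℝ → ℝ → ℝ := fun ε t =>
    (kinetic p (pushCurve (perturb ξ ε) μ) (transportedField (perturb ξ ε) μ v) t).toReal with hk
  set F : ℝ → ℝ := fun t => (Lq q (μ t)).toReal with hF
  set V : ℝ → ℝ := fun t => (kinetic p μ v t).toReal with hVdef
  have hl0 : ∀ t, l 0 t = F t := fun t => by simp only [hl, hF, pushCurve_perturb_zero]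
  have hk0 : ∀ᵐ t ∂I, k 0 t = V t := by
    filter_upwards [hgood] with t ⟨_, h1, _, _, h4, h5⟩
    simp only [hk, hVdef]
    rw [((hkin μ v t h1 h4 h5).2.2.1 0 (hs2 h0mem)).2, kinetic]
    simp
  have hlm : ∀ ε ∈ Metric.ball (0 : ℝ) δ, AEMeasurable (l ε) I := by
    intro ε hε
    refine ⟨_, (measurable_lintegral_detPow hξ hu q ε).ennreal_toReal, ?_⟩
    filter_upwards [hgood] with t ⟨ht, h1, h2, h3, _, _⟩
    simp only [hl]
    rw [((hLq μ t h1 h2 h3).2.1 ε (hs1 hε)).2]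
    congr 1
    refine lintegral_congr_ae ?_
    rw [← hκμ t ht] at h2 ⊢
    filter_upwards [huκ t h2] with x hx
    rw [hx]
  have hkm : ∀ ε ∈ Metric.ball (0 : ℝ) δ, AEMeasurable (k ε) I := by
    intro ε hε
    refine ⟨_, (measurable_lintegral_lagrangianField κ hξ hw p ε).ennreal_toReal, ?_⟩
    filter_upwards [hgood] with t ⟨ht, h1, _, _, h4, h5⟩
    simp only [hk]
    rw [((hkin μ v t h1 h4 h5).2.2.1 ε (hs2 hε)).2, hkform ε t ht]
  have hFm : AEMeasurable F I := hLm.ennreal_toReal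
  have hVm : AEMeasurable V I := hKm.ennreal_toReal
  have hslice : ∀ᵐ t ∂I, 0 < F t ∧ 0 < V t ∧
      (∀ ε ∈ Metric.ball (0 : ℝ) δ, ∀ ε' ∈ Metric.ball (0 : ℝ) δ,
        |l ε t - l ε' t| ≤ max C₁ C₂ * F t * |ε - ε'|) ∧
      (∀ ε ∈ Metric.ball (0 : ℝ) δ, ∀ ε' ∈ Metric.ball (0 : ℝ) δ,
        |k ε t - k ε' t| ≤ max C₁ C₂ * V t * |ε - ε'|) ∧
      HasDerivAt (fun ε => l ε t) ((1 - q) * ∫ x in Ω, pressureDensity q μ ξ t x) 0 ∧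
      HasDerivAt (fun ε => k ε t) (p * ∫ x, kineticDensity p v ξ t x ∂μ t) 0 := by
    filter_upwards [hgood] with t ⟨ht, h1, h2, h3, h4, h5⟩
    obtain ⟨a1, _, a3, _, a5⟩ := hLq μ t h1 h2 h3
    obtain ⟨_, b1, _, b3, _, b5⟩ := hkin μ v t h1 h4 h5
    refine ⟨a1, b1, fun ε hε ε' hε' => (a3 ε (hs1 hε) ε' (hs1 hε')).trans ?_,
      fun ε hε ε' hε' => (b3 ε (hs2 hε) ε' (hs2 hε')).trans ?_, ?_, b5⟩
    · gcongr
      exact le_max_left _ _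
    · gcongr
      exact le_max_right _ _
    · rw [setIntegral_pressureDensity hq hΩm h2 (hμ.mem t ht).compl_eq_zero]
      exact a5
  have hprod' : ∀ᵐ t ∂I, (∀ ε ∈ Metric.ball (0 : ℝ) δ, 0 < l ε t ∧ 0 < k ε t) ∧
      ∀ ε ∈ Metric.ball (0 : ℝ) δ, ∀ ε' ∈ Metric.ball (0 : ℝ) δ,
        |l ε t ^ α * k ε t ^ β - l ε' t ^ α * k ε' t ^ β| ≤
          C₃ * (F t ^ α * V t ^ β) * |ε - ε'| := by
    filter_upwards [hslice, hk0] with t ⟨h1, h2, h3, h4, _, _⟩ h5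
    exact hprod (F t) h1 (V t) h2 (fun ε => l ε t) (fun ε => k ε t) (hl0 t) h5 δ
      (min_le_right _ _) hδ h3 h4
  have hint : Integrable (fun t => F t ^ α * V t ^ β) I := by
    refine ⟨((hFm.pow_const α).mul (hVm.pow_const β)).aestronglyMeasurable, ?_⟩
    rw [hasFiniteIntegral_iff_ofReal (ae_of_all _ fun t => by positivity)]
    refine lt_of_le_of_lt (lintegral_mono_ae ?_) hfin
    filter_upwards [hslice] with t ⟨h1, h2, _⟩
    rw [ENNReal.ofReal_mul (by positivity), ← ENNReal.ofReal_rpow_of_pos h1,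
      ← ENNReal.ofReal_rpow_of_pos h2, ENNReal.ofReal_toReal (ENNReal.toReal_pos_iff.1 h1).2.ne,
      ENNReal.ofReal_toReal (ENNReal.toReal_pos_iff.1 h2).2.ne]
  set P : ℝ → ℝ := fun t => ∫ x in Ω, pressureDensity q μ ξ t x with hP
  set Q : ℝ → ℝ := fun t => ∫ x, kineticDensity p v ξ t x ∂μ t with hQ
  -- The differentiation lemma is applied to `l ε` with the frozen weight `F^(α-1) V^β`: the
  -- Lipschitz bound `C F` restores `F^α V^β`, and measurability of `P` comes for free.
  have hPint : Integrable (fun t => F t ^ (α - 1) * V t ^ β * P t) I := by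
    have := (hasDerivAt_integral_of_abs_sub_le (m := I)
      (f := fun ε t => F t ^ (α - 1) * V t ^ β * l ε t)
      (f' := fun t => F t ^ (α - 1) * V t ^ β * ((1 - q) * P t))
      (bound := fun t => max C₁ C₂ * (F t ^ α * V t ^ β)) hδ
      (fun ε hε => (((hFm.pow_const _).mul (hVm.pow_const _)).mul (hlm ε hε)).aestronglyMeasurable)
      (hint.congr (by
        filter_upwards [hslice] with t ⟨h1, _⟩
        rw [hl0, Real.rpow_sub_one h1.ne']
        field_simp))
      (hint.const_mul _)
      (by
        filter_upwards [hslice] with t ⟨h1, h2, h3, _⟩ ε hε ε' hε'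
        rw [← mul_sub, abs_mul, abs_of_nonneg (by positivity)]
        calc _ ≤ F t ^ (α - 1) * V t ^ β * (max C₁ C₂ * F t * |ε - ε'|) := by
              gcongr
              exact h3 ε hε ε' hε'
          _ = _ := by
              rw [Real.rpow_sub_one h1.ne']
              field_simp)
      (by
        filter_upwards [hslice] with t ⟨_, _, _, _, h5, _⟩
        exact h5.const_mul _)).2.1
    refine (this.const_mul (1 - q)⁻¹).congr (ae_of_all _ fun t => ?_)
    have : 1 - q ≠ 0 := by linarith
    field_simp
  have hQint : Integrable (fun t => F t ^ α * V t ^ (β - 1) * Q t) I := by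
    have := (hasDerivAt_integral_of_abs_sub_le (m := I)
      (f := fun ε t => F t ^ α * V t ^ (β - 1) * k ε t)
      (f' := fun t => F t ^ α * V t ^ (β - 1) * (p * Q t))
      (bound := fun t => max C₁ C₂ * (F t ^ α * V t ^ β)) hδ
      (fun ε hε => (((hFm.pow_const _).mul (hVm.pow_const _)).mul (hkm ε hε)).aestronglyMeasurable)
      (hint.congr (by
        filter_upwards [hslice, hk0] with t ⟨_, h1, _⟩ h2
        rw [h2, Real.rpow_sub_one h1.ne']
        field_simp))
      (hint.const_mul _)
      (by
        filter_upwards [hslice] with t ⟨_, h2, _, h4, _⟩ ε hε ε' hε'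
        rw [← mul_sub, abs_mul, abs_of_nonneg (by positivity)]
        calc _ ≤ F t ^ α * V t ^ (β - 1) * (max C₁ C₂ * V t * |ε - ε'|) := by
              gcongr
              exact h4 ε hε ε' hε'
          _ = _ := by
              rw [Real.rpow_sub_one h2.ne']
              field_simp)
      (by
        filter_upwards [hslice] with t ⟨_, _, _, _, _, h6⟩
        exact h6.const_mul _)).2.1
    refine (this.const_mul p⁻¹).congr (ae_of_all _ fun t => ?_)
    field_simp
  obtain ⟨m1, -, m3, -⟩ := hasDerivAt_integral_of_abs_sub_le (m := I)
    (f := fun ε t => l ε t ^ α * k ε t ^ β)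
    (f' := fun t => α * (F t ^ (α - 1) * V t ^ β * ((1 - q) * P t)) +
      β * (F t ^ α * V t ^ (β - 1) * (p * Q t)))
    (bound := fun t => C₃ * (F t ^ α * V t ^ β)) hδ
    (fun ε hε => (((hlm ε hε).pow_const _).mul ((hkm ε hε).pow_const _)).aestronglyMeasurable)
    (hint.congr (by
      filter_upwards [hk0] with t h2
      rw [hl0, h2]))
    (hint.const_mul _) (hprod'.mono fun t ht => ht.2)
    (by
      filter_upwards [hslice, hk0] with t ⟨h1, h2, _, _, h5, h6⟩ h7
      exact hasDerivAt_rpow_mul_rpow h1 h2 (hl0 t) h7 h5 h6)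
  -- Positivity of both real energies on the ball lets the extended powers be replaced by real ones,
  -- even for negative `β`.
  have hmod : ∀ ε ∈ Metric.ball (0 : ℝ) δ, modifiedEnergy p q α β μ v ξ ε =
      ENNReal.ofReal (∫ t, l ε t ^ α * k ε t ^ β ∂I) := by
    intro ε hε
    rw [modifiedEnergy, energy, ofReal_integral_eq_lintegral_ofReal (m1 ε hε)
      (ae_of_all _ fun t => by positivity)]
    refine lintegral_congr_ae ?_
    filter_upwards [hprod'] with t ⟨h1, _⟩
    obtain ⟨h2, h3⟩ := h1 ε hε
    rw [ENNReal.ofReal_mul (by positivity), ← ENNReal.ofReal_rpow_of_pos h2,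
      ← ENNReal.ofReal_rpow_of_pos h3, ENNReal.ofReal_toReal (ENNReal.toReal_pos_iff.1 h2).2.ne,
      ENNReal.ofReal_toReal (ENNReal.toReal_pos_iff.1 h3).2.ne]
  have hinterval : ∀ f : ℝ → ℝ, ∫ t in (0 : ℝ)..1, f t = ∫ t, f t ∂I := fun f => by
    rw [intervalIntegral.integral_of_le zero_le_one, hI, integral_Icc_eq_integral_Ioc]
  refine ⟨?_, ?_, ?_, ?_, ?_⟩
  · filter_upwards [hgood] with t ⟨_, h1, h2, h3, h4, h5⟩
    have ha := hLq μ t h1 h2 h3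
    have hb := hkin μ v t h1 h4 h5
    exact ⟨h2, h3, hb.1, ha.2.2.2.1.integrableOn, hb.2.2.2.2.1⟩
  · rw [intervalIntegrable_iff_integrableOn_Icc_of_le zero_le_one]
    exact hPint
  · rw [intervalIntegrable_iff_integrableOn_Icc_of_le zero_le_one]
    exact hQint
  · filter_upwards [Metric.ball_mem_nhds (0 : ℝ) hδ] with ε hε
    rw [hmod ε hε]
    exact ENNReal.ofReal_lt_top
  · rw [hinterval, hinterval]
    have hval : ∫ t, (α * (F t ^ (α - 1) * V t ^ β * ((1 - q) * P t)) +
        β * (F t ^ α * V t ^ (β - 1) * (p * Q t))) ∂I =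
        α * (1 - q) * (∫ t, F t ^ (α - 1) * V t ^ β * P t ∂I) +
          p * β * ∫ t, F t ^ α * V t ^ (β - 1) * Q t ∂I := by
      rw [← integral_const_mul, ← integral_const_mul,
        ← integral_add (hPint.const_mul _) (hQint.const_mul _)]
      congr 1
      ext t
      ring
    rw [hval] at m3
    refine m3.congr_of_eventuallyEq ?_
    filter_upwards [Metric.ball_mem_nhds (0 : ℝ) hδ] with ε hε
    rw [hmod ε hε, ENNReal.toReal_ofReal (integral_nonneg fun t => by positivity)]
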